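/- Let $X$ be the set of sequences $a=(a_1,a_2,\dots)$ of bounded measurable $2\pi$-periodic functions $a_i:\mathbb R\to\mathbb C$ for which there is $l>0$ with $\sup_x|a_i(x)|\le l^i$ for all $i\ge 1$. For $a\in X$ consider the differential equation $$\frac{dv}{dx}=\sum_{i\ge 1}a_i(x)\,v^{i+1}\qquad(\ast)$$ where a solution on $[0,2\pi]$ is a Lipschitz function $v:[0,2\pi]\to\mathbb C$ satisfying $(\ast)$ almost everywhere. The *center set* $\mathcal C\subset X$ is the set of those $a$ for which, for all sufficiently small $r\in\mathbb C$, the solution of $(\ast)$ with $v(0)=r$ satisfies $v(2\pi)=v(0)$. For $a,b\in X$ let $a*b=(a_1*b_1,a_2*b_2,\dots)$ and $a^{-1}=(a_1^{-1},a_2^{-1},\dots)$, where $(a_i*b_i)(t)=2a_i(2t)$ for $0<t\le\pi$, $(a_i*b_i)(t)=2b_i(2t-2\pi)$ for $\pi<t\le2\pi$, and $a_i^{-1}(t)=-a_i(2\pi-t)$ for $0<t\le 2\pi$ (all extended $2\pi$-periodically). The basic iterated integrals are $$I_{i_1,\dots,i_k}(a)=\int\cdots\int_{0\le s_1\le\cdots\le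 s_k\le2\pi}a_{i_k}(s_k)\cdots a_{i_1}(s_1)\,ds_k\cdots ds_1 ,\qquad k\ge 0,$$ with value $1$ for $k=0$. Write $a\sim b$ if $I_{i_1,\dots,i_k}(a*b^{-1})=0$ for all $k\ge1$ and $i_1,\dots,i_k\ge1$. This is an equivalence relation; the set $G(X)$ of classes $[a]$ is a group under $[a]\cdot[b]=[a*b]$, the basic iterated integrals are constant on classes, and $G(X)$ carries the weakest topology making all of them continuous. Let $G_c[[r]]$ be the set of complex power series $f(r)=r+\sum_{k\ge1}d_k(f)r^{k+1}$ convergent in some neighbourhood of $0$, with the group multiplication given by composition in the order $f\cdot g:=g\circ f$, and with the weakest topology making all $d_k$ continuous. **Theorem.** $G(X)$ and $G_c[[r]]$ are topological groups. For every $a\in X$ there is a unique $P(a)\in G_c[[r]]$ (the first return map) such that, for all sufficiently small $r\in\mathbb C$, equation $(\ast)$ has a unique solution $v$ on $[0,2\pi]$ with $v(0)=r$, and $v(2\pi)=P(a)(r)$. For all $a,b\in X$, $$P(a*b)=P(b)\circ P(a).$$ The formula $\widehat P([a])=P(a)$ gives a well-defined map $\widehat P:G(X)\to G_c[[r]]$,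 which is a continuous surjective group homomorphism. Its kernel $\widehat{\mathcal C}$ is the image of $\mathcal C$ in $G(X)$, and $\widehat{\mathcal C}$ is a non-trivial, normal, closed subgroup of $G(X)$ which, in the topology induced from $G(X)$, is contractible to a point, arcwise (path) connected, and locally simply and arcwise connected (every neighbourhood of every point contains a simply connected, in particular path connected, open neighbourhood of that point). -/

import Mathlib

open Filter Topology MeasureTheory

namespace CenterProblem

noncomputable section

/-! ### The space of coefficient sequences -/

/-- A sequence `(a₁, a₂, …)` of coefficients of the equation `v' = ∑ aᵢ(x) v ^ (i + 1)`: bounded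
measurable complex functions on the unit circle, written as `2π`-periodic functions on `ℝ`, such
that `sup |aᵢ| ≤ l ^ i` for all `i ≥ 1` and some positive `l`. -/
@[ext] structure CoeffSeq where
  /-- the coefficients `aᵢ`, `i = 1, 2, …` -/
  coeff : ℕ+ → ℝ → ℂ
  measurable_coeff : ∀ i, Measurable (coeff i)
  periodic_coeff : ∀ i, Function.Periodic (coeff i) (2 * Real.pi)
  bound_coeff : ∃ l : ℝ, 0 < l ∧ ∀ (i : ℕ+) (x : ℝ), ‖coeff i x‖ ≤ l ^ (i : ℕ)

namespace CoeffSeq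

/-- The zero sequence. -/
instance : Zero CoeffSeq where
  zero :=
    { coeff := fun _ _ => 0
      measurable_coeff := fun _ => measurable_const
      periodic_coeff := fun _ _ => rfl
      bound_coeff := ⟨1, one_pos, fun i x => by simp⟩ }

/-- Concatenation of two functions on the circle: the `2π`-periodic function that equals
`2 f (2 t)` for `0 < t ≤ π` and `2 g (2 t - 2 π)` for `π < t ≤ 2 π`. -/
def concatFun (f g : ℝ → ℂ) (t : ℝ) : ℂ :=
  if toIocMod Real.two_pi_pos 0 t ≤ Real.pi then
    2 * f (2 * toIocMod Real.two_pi_pos 0 t)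
  else
    2 * g (2 * toIocMod Real.two_pi_pos 0 t - 2 * Real.pi)

theorem measurable_toIocMod : Measurable (fun t : ℝ => toIocMod Real.two_pi_pos 0 t) := by
  simp only [toIocMod_eq_sub_fract_mul]
  fun_prop

theorem measurable_concatFun {f g : ℝ → ℂ} (hf : Measurable f) (hg : Measurable g) :
    Measurable (concatFun f g) := by
  have h := measurable_toIocMod
  refine Measurable.ite (h measurableSet_Iic) ?_ ?_
  · exact (hf.comp (h.const_mul 2)).const_mul 2
  · exact (hg.comp ((h.const_mul 2).sub_const _)).const_mul 2

theorem concatFun_of_le (f g : ℝ → ℂ) {t : ℝ} (h0 : 0 < t) (h1 : t ≤ Real.pi) :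
    concatFun f g t = 2 * f (2 * t) := by
  have : toIocMod Real.two_pi_pos 0 t = t :=
    (toIocMod_eq_self _).2 ⟨h0, by linarith [Real.pi_pos]⟩
  simp [concatFun, this, h1]

theorem concatFun_of_lt (f g : ℝ → ℂ) {t : ℝ} (h0 : Real.pi < t) (h1 : t ≤ 2 * Real.pi) :
    concatFun f g t = 2 * g (2 * t - 2 * Real.pi) := by
  have : toIocMod Real.two_pi_pos 0 t = t :=
    (toIocMod_eq_self _).2 ⟨by linarith [Real.pi_pos], by linarith⟩
  simp [concatFun, this, not_le.2 h0]

/-- The product `a * b = (a₁ * b₁, a₂ * b₂, …)`. -/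
instance : Mul CoeffSeq where
  mul a b :=
    { coeff := fun i => concatFun (a.coeff i) (b.coeff i)
      measurable_coeff := fun i => measurable_concatFun (a.measurable_coeff i) (b.measurable_coeff i)
      periodic_coeff := fun i t => by simp [concatFun]
      bound_coeff := by
        obtain ⟨l, hl, ha⟩ := a.bound_coeff
        obtain ⟨m, hm, hb⟩ := b.bound_coeff
        refine ⟨2 * (l + m), by positivity, fun i x => ?_⟩
        have h2 : (2 : ℝ) ≤ 2 ^ (i : ℕ) := le_self_pow₀ (by norm_num) i.ne_zero
        have h3 : l ^ (i : ℕ) ≤ (l + m) ^ (i : ℕ) := by gcongr; linarith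
        have h4 : m ^ (i : ℕ) ≤ (l + m) ^ (i : ℕ) := by gcongr; linarith
        rw [mul_pow, concatFun]
        split_ifs
        · rw [norm_mul, Complex.norm_ofNat]
          exact mul_le_mul h2 ((ha i _).trans h3) (norm_nonneg _) (by positivity)
        · rw [norm_mul, Complex.norm_ofNat]
          exact mul_le_mul h2 ((hb i _).trans h4) (norm_nonneg _) (by positivity) }

/-- The inverse `a⁻¹`, with `aᵢ⁻¹(t) = -aᵢ(2π - t)`. -/
instance : Inv CoeffSeq where
  inv a :=
    { coeff := fun i t => -a.coeff i (2 * Real.pi - t)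
      measurable_coeff := fun i => ((a.measurable_coeff i).comp (by fun_prop)).neg
      periodic_coeff := fun i t => by
        have := (a.periodic_coeff i) (2 * Real.pi - (t + 2 * Real.pi))
        simp only [neg_inj]
        rw [← this]; congr 1; ring
      bound_coeff := by
        obtain ⟨l, hl, ha⟩ := a.bound_coeff
        exact ⟨l, hl, fun i x => by simpa using ha i _⟩ }

/-! ### Basic iterated integrals -/

/-- Iterated integrals with variable upper limit. The word lists the indices starting with the
outermost integration: `iterIntTo a [i_k, …, i_1] x` is the integral of
`a_{i_k}(s_k) ⋯ a_{i_1}(s_1)` over `0 ≤ s_1 ≤ ⋯ ≤ s_k ≤ x`, and the empty word gives `1`. -/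
def iterIntTo (a : CoeffSeq) : List ℕ+ → ℝ → ℂ
  | [], _ => 1
  | i :: w, x => ∫ s in (0 : ℝ)..x, a.coeff i s * iterIntTo a w s

/-- The basic iterated integrals, over `0 ≤ s_1 ≤ ⋯ ≤ s_k ≤ 2π`. -/
def iterInt (w : List ℕ+) (a : CoeffSeq) : ℂ := iterIntTo a w (2 * Real.pi)

/-- The set of universal centers: all non-constant basic iterated integrals vanish. -/
def universalCenters : Set CoeffSeq := {a | ∀ w : List ℕ+, w ≠ [] → iterInt w a = 0}

/-! ### Concatenation of paths and iterated integrals -/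

/-- Convolution of functions on words along all ways of cutting a word in two. -/
def conv (f g : List ℕ+ → ℂ) : List ℕ+ → ℂ
  | [] => f [] * g []
  | i :: w => f [] * g (i :: w) + conv (fun u => f (i :: u)) g w

/-- The unit for the convolution. -/
def convOne : List ℕ+ → ℂ
  | [] => 1
  | _ :: _ => 0

theorem conv_zero (g : List ℕ+ → ℂ) (w : List ℕ+) : conv (fun _ => 0) g w = 0 := by
  induction w with
  | nil => simp [conv]
  | cons i w ih => simp [conv, ih]

theorem conv_add (f f' g : List ℕ+ → ℂ) (w : List ℕ+) :
    conv (fun u => f u + f' u) g w = conv f g w + conv f' g w := by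
  induction w generalizing f f' with
  | nil => simp [conv]; ring
  | cons i w ih => simp only [conv, ih]; ring

theorem conv_smul (c : ℂ) (f g : List ℕ+ → ℂ) (w : List ℕ+) :
    conv (fun u => c * f u) g w = c * conv f g w := by
  induction w generalizing f with
  | nil => simp [conv]; ring
  | cons i w ih => simp only [conv, ih]; ring

theorem conv_assoc (f g h : List ℕ+ → ℂ) (w : List ℕ+) :
    conv (conv f g) h w = conv f (conv g h) w := by
  induction w generalizing f g h with
  | nil => simp [conv]; ring
  | cons i w ih =>
    have : (fun u => conv f g (i :: u)) =
        fun u => f [] * (fun u => g (i :: u)) u + conv (fun u => f (i :: u)) g u := by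
      funext u; simp [conv]
    simp only [conv, conv_add, conv_smul, ih]
    ring

theorem convOne_conv (g : List ℕ+ → ℂ) : conv convOne g = g := by
  funext w
  cases w with
  | nil => simp [conv, convOne]
  | cons i w => simp [conv, convOne, conv_zero]

theorem conv_convOne (f : List ℕ+ → ℂ) : conv f convOne = f := by
  funext w
  induction w generalizing f with
  | nil => simp [conv, convOne]
  | cons i w ih => simp [conv, convOne, ih]

theorem intervalIntegrable_coeff (a : CoeffSeq) (i : ℕ+) (x y : ℝ) :
    IntervalIntegrable (a.coeff i) volume x y := by
  obtain ⟨l, -, h⟩ := a.bound_coeff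
  exact (intervalIntegrable_const (c := l ^ (i : ℕ))).mono_fun
    (a.measurable_coeff i).aestronglyMeasurable
    (Eventually.of_forall fun t => (h i t).trans (le_abs_self _))

theorem continuous_iterIntTo (a : CoeffSeq) (w : List ℕ+) : Continuous (iterIntTo a w) := by
  induction w with
  | nil => simpa only [iterIntTo] using continuous_const
  | cons i w ih =>
    simp only [iterIntTo]
    exact intervalIntegral.continuous_primitive
      (fun x y => (intervalIntegrable_coeff a i x y).mul_continuousOn ih.continuousOn) 0

theorem integral_conv (b : ℝ → ℂ) (F : ℝ → List ℕ+ → ℂ) (g : List ℕ+ → ℂ) (w : List ℕ+) (x y : ℝ)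
    (hF : ∀ u, IntervalIntegrable (fun s => b s * F s u) volume x y) :
    IntervalIntegrable (fun s => b s * conv (F s) g w) volume x y ∧
      ∫ s in x..y, b s * conv (F s) g w = conv (fun u => ∫ s in x..y, b s * F s u) g w := by
  induction w generalizing F with
  | nil =>
    simp only [conv, ← mul_assoc]
    exact ⟨(hF []).mul_const _, by simp⟩
  | cons i w ih =>
    obtain ⟨h1, h2⟩ := ih (fun s u => F s (i :: u)) (fun u => hF (i :: u))
    simp only [conv, mul_add, ← mul_assoc]
    refine ⟨((hF []).mul_const _).add h1, ?_⟩
    rw [intervalIntegral.integral_add ((hF []).mul_const _) h1, h2]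
    simp

theorem iterIntTo_mul_left (a b : CoeffSeq) (w : List ℕ+) {x : ℝ} (h0 : 0 ≤ x)
    (h1 : x ≤ Real.pi) : iterIntTo (a * b) w x = iterIntTo a w (2 * x) := by
  induction w generalizing x with
  | nil => simp [iterIntTo]
  | cons i w ih =>
    simp only [iterIntTo]
    have : ∫ s in (0 : ℝ)..x, (a * b).coeff i s * iterIntTo (a * b) w s =
        ∫ s in (0 : ℝ)..x, 2 * (a.coeff i (2 * s) * iterIntTo a w (2 * s)) := by
      refine intervalIntegral.integral_congr_ae (Eventually.of_forall fun s hs => ?_)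
      rw [Set.uIoc_of_le h0] at hs
      rw [ih hs.1.le (hs.2.trans h1)]
      change concatFun (a.coeff i) (b.coeff i) s * _ = _
      rw [concatFun_of_le _ _ hs.1 (hs.2.trans h1)]
      ring
    rw [this, intervalIntegral.integral_const_mul,
      intervalIntegral.integral_comp_mul_left (fun s => a.coeff i s * iterIntTo a w s) two_ne_zero]
    simp

theorem iterIntTo_mul_right (a b : CoeffSeq) (w : List ℕ+) {x : ℝ} (h0 : Real.pi ≤ x)
    (h1 : x ≤ 2 * Real.pi) :
    iterIntTo (a * b) w x =
      conv (fun u => iterIntTo b u (2 * x - 2 * Real.pi)) (fun u => iterInt u a) w := by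
  induction w generalizing x with
  | nil => simp [iterIntTo, conv, iterInt]
  | cons i w ih =>
    have hint : ∀ p q : ℝ, IntervalIntegrable
        (fun s => (a * b).coeff i s * iterIntTo (a * b) w s) volume p q := fun p q =>
      (intervalIntegrable_coeff (a * b) i p q).mul_continuousOn
        (continuous_iterIntTo _ w).continuousOn
    have hleft : ∫ s in (0 : ℝ)..Real.pi, (a * b).coeff i s * iterIntTo (a * b) w s =
        iterInt (i :: w) a :=
      iterIntTo_mul_left a b (i :: w) Real.pi_pos.le le_rfl
    have hright : ∫ s in Real.pi..x, (a * b).coeff i s * iterIntTo (a * b) w s =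
        ∫ s in Real.pi..x, 2 * ((fun t => b.coeff i t * conv (fun u => iterIntTo b u t)
          (fun u => iterInt u a) w) (2 * s - 2 * Real.pi)) := by
      refine intervalIntegral.integral_congr_ae (Eventually.of_forall fun s hs => ?_)
      rw [Set.uIoc_of_le h0] at hs
      rw [ih hs.1.le (hs.2.trans h1)]
      change concatFun (a.coeff i) (b.coeff i) s * _ = _
      rw [concatFun_of_lt _ _ hs.1 (hs.2.trans h1)]
      ring
    have hconv := (integral_conv (b.coeff i) (fun s u => iterIntTo b u s) (fun u => iterInt u a) w
      0 (2 * x - 2 * Real.pi) (fun u => (intervalIntegrable_coeff b i _ _).mul_continuousOn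
        (continuous_iterIntTo b u).continuousOn)).2
    rw [iterIntTo, ← intervalIntegral.integral_add_adjacent_intervals (hint 0 Real.pi)
      (hint Real.pi x), hleft, hright, intervalIntegral.integral_const_mul,
      intervalIntegral.integral_comp_mul_sub (fun t => b.coeff i t * conv
        (fun u => iterIntTo b u t) (fun u => iterInt u a) w) two_ne_zero]
    simp only [conv, iterIntTo, sub_self, one_mul]
    rw [hconv]
    simp

theorem iterInt_mul (a b : CoeffSeq) :
    (fun w => iterInt w (a * b)) = conv (fun w => iterInt w b) (fun w => iterInt w a) := by
  funext w
  have := iterIntTo_mul_right a b w (by linarith [Real.pi_pos]) (le_refl (2 * Real.pi))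
  rw [show 2 * (2 * Real.pi) - 2 * Real.pi = 2 * Real.pi by ring] at this
  exact this

theorem conv_iterIntTo_inv (a : CoeffSeq) (w : List ℕ+) (x : ℝ) :
    conv (fun u => iterIntTo a⁻¹ u x) (fun u => iterInt u a) w =
      iterIntTo a w (2 * Real.pi - x) := by
  induction w generalizing x with
  | nil => simp [conv, iterIntTo, iterInt]
  | cons i w ih =>
    have hint : ∀ p q : ℝ, IntervalIntegrable
        (fun s => a.coeff i s * iterIntTo a w s) volume p q := fun p q =>
      (intervalIntegrable_coeff a i p q).mul_continuousOn (continuous_iterIntTo _ w).continuousOn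
    have hconv := (integral_conv (a⁻¹.coeff i) (fun s u => iterIntTo a⁻¹ u s)
      (fun u => iterInt u a) w 0 x
      (fun u => (intervalIntegrable_coeff a⁻¹ i _ _).mul_continuousOn
        (continuous_iterIntTo a⁻¹ u).continuousOn)).2
    simp only [conv, iterIntTo, one_mul]
    rw [← hconv]
    simp only [ih]
    have : ∀ s, a⁻¹.coeff i s * iterIntTo a w (2 * Real.pi - s) =
        -((fun t => a.coeff i t * iterIntTo a w t) (2 * Real.pi - s)) := by
      intro s
      change -a.coeff i (2 * Real.pi - s) * _ = _
      ring
    simp only [this, intervalIntegral.integral_neg]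
    rw [intervalIntegral.integral_comp_sub_left
      (fun t => a.coeff i t * iterIntTo a w t) (2 * Real.pi), sub_zero]
    change (∫ s in (0 : ℝ)..(2 * Real.pi), a.coeff i s * iterIntTo a w s) + _ = _
    rw [← intervalIntegral.integral_add_adjacent_intervals (hint 0 (2 * Real.pi - x))
      (hint (2 * Real.pi - x) (2 * Real.pi))]
    ring

theorem conv_iterInt_inv_self (a : CoeffSeq) :
    conv (fun w => iterInt w a⁻¹) (fun w => iterInt w a) = convOne := by
  funext w
  have h := conv_iterIntTo_inv a w (2 * Real.pi)
  rw [sub_self] at h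
  change conv (fun u => iterIntTo a⁻¹ u (2 * Real.pi)) (fun u => iterInt u a) w = _
  rw [h]
  cases w <;> simp [iterIntTo, convOne]

theorem inv_inv' (a : CoeffSeq) : a⁻¹⁻¹ = a := by
  ext i t
  change - -a.coeff i (2 * Real.pi - (2 * Real.pi - t)) = _
  simp

theorem conv_iterInt_self_inv (a : CoeffSeq) :
    conv (fun w => iterInt w a) (fun w => iterInt w a⁻¹) = convOne := by
  have := conv_iterInt_inv_self a⁻¹
  rwa [inv_inv'] at this

theorem iterInt_zero : (fun w => iterInt w 0) = convOne := by
  funext w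
  cases w with
  | nil => simp [iterInt, iterIntTo, convOne]
  | cons i w =>
    have : ∀ s, (0 : CoeffSeq).coeff i s = 0 := fun _ => rfl
    simp [iterInt, iterIntTo, convOne, this]

theorem mem_universalCenters_iff (a : CoeffSeq) :
    a ∈ universalCenters ↔ (fun w => iterInt w a) = convOne := by
  constructor
  · intro h
    funext w
    cases w with
    | nil => simp [iterInt, iterIntTo, convOne]
    | cons i w => simpa [convOne] using h (i :: w) (by simp)
  · rintro h (_ | ⟨i, w⟩) hw
    · exact absurd rfl hw
    · exact congrFun h (i :: w)

/-- Two sequences are equivalent iff they have the same iterated integrals. -/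
theorem mul_inv_mem_universalCenters_iff (a b : CoeffSeq) :
    a * b⁻¹ ∈ universalCenters ↔ (fun w => iterInt w a) = fun w => iterInt w b := by
  rw [mem_universalCenters_iff, iterInt_mul]
  constructor
  · intro h
    have h2 : conv (fun w => iterInt w b) (conv (fun w => iterInt w b⁻¹) fun w => iterInt w a) =
        fun w => iterInt w b := by rw [h, conv_convOne]
    have h3 : conv (conv (fun w => iterInt w b) (fun w => iterInt w b⁻¹)) (fun w => iterInt w a) =
        fun w => iterInt w b := by
      funext w; rw [conv_assoc, h2]
    rwa [conv_iterInt_self_inv, convOne_conv] at h3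
  · intro h
    rw [h, conv_iterInt_inv_self]

/-- The equivalence relation: `a ∼ b` iff `a * b⁻¹` is a universal center. -/
instance setoid : Setoid CoeffSeq where
  r a b := a * b⁻¹ ∈ universalCenters
  iseqv :=
    { refl := fun a => (mul_inv_mem_universalCenters_iff a a).2 rfl
      symm := fun {a b} h => (mul_inv_mem_universalCenters_iff b a).2
        ((mul_inv_mem_universalCenters_iff a b).1 h).symm
      trans := fun {a b c} h h' => (mul_inv_mem_universalCenters_iff a c).2
        (((mul_inv_mem_universalCenters_iff a b).1 h).trans
          ((mul_inv_mem_universalCenters_iff b c).1 h')) }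

theorem equiv_iff (a b : CoeffSeq) :
    a ≈ b ↔ (fun w => iterInt w a) = fun w => iterInt w b :=
  mul_inv_mem_universalCenters_iff a b

end CoeffSeq

/-! ### The group of equivalence classes -/

/-- The set `G(X)` of equivalence classes. -/
def GX : Type := Quotient CoeffSeq.setoid

namespace GX

/-- The class `[a]`. -/
def mk (a : CoeffSeq) : GX := Quotient.mk CoeffSeq.setoid a

theorem mk_eq_mk_iff (a b : CoeffSeq) :
    mk a = mk b ↔ (fun w => CoeffSeq.iterInt w a) = fun w => CoeffSeq.iterInt w b :=
  Quotient.eq.trans (CoeffSeq.equiv_iff a b)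

/-- The basic iterated integrals as functions on `G(X)`. -/
def iterInt (w : List ℕ+) : GX → ℂ :=
  Quotient.lift (CoeffSeq.iterInt w) fun a b h => congrFun ((CoeffSeq.equiv_iff a b).1 h) w

/-- `[a] · [b] = [a * b]`. -/
instance : Mul GX where
  mul := Quotient.map₂ (· * ·) fun a a' h b b' h' => by
    rw [CoeffSeq.equiv_iff] at h h' ⊢
    rw [CoeffSeq.iterInt_mul, CoeffSeq.iterInt_mul, h, h']

/-- The unit is `[0]`. -/
instance : One GX where
  one := mk 0

/-- `[a]⁻¹ = [a⁻¹]`. -/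
instance : Inv GX where
  inv := Quotient.map (·⁻¹) fun a b h => by
    rw [CoeffSeq.equiv_iff] at h ⊢
    have h1 : CoeffSeq.conv (CoeffSeq.conv (fun w => CoeffSeq.iterInt w a⁻¹)
        (fun w => CoeffSeq.iterInt w a)) (fun w => CoeffSeq.iterInt w b⁻¹) =
        fun w => CoeffSeq.iterInt w b⁻¹ := by
      rw [CoeffSeq.conv_iterInt_inv_self, CoeffSeq.convOne_conv]
    rw [← h1]
    funext w
    rw [CoeffSeq.conv_assoc, h, CoeffSeq.conv_iterInt_self_inv, CoeffSeq.conv_convOne]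

theorem mk_mul (a b : CoeffSeq) : mk (a * b) = mk a * mk b := rfl

theorem mk_inv (a : CoeffSeq) : mk a⁻¹ = (mk a)⁻¹ := rfl

theorem mk_zero : mk 0 = 1 := rfl

instance : Group GX where
  mul_assoc := by
    rintro ⟨a⟩ ⟨b⟩ ⟨c⟩
    refine (mk_eq_mk_iff _ _).2 ?_
    simp only [CoeffSeq.iterInt_mul]
    funext w
    rw [CoeffSeq.conv_assoc]
  one_mul := by
    rintro ⟨a⟩
    refine (mk_eq_mk_iff (0 * a) a).2 ?_
    rw [CoeffSeq.iterInt_mul, CoeffSeq.iterInt_zero, CoeffSeq.conv_convOne]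
  mul_one := by
    rintro ⟨a⟩
    refine (mk_eq_mk_iff (a * 0) a).2 ?_
    rw [CoeffSeq.iterInt_mul, CoeffSeq.iterInt_zero, CoeffSeq.convOne_conv]
  inv_mul_cancel := by
    rintro ⟨a⟩
    refine (mk_eq_mk_iff (a⁻¹ * a) 0).2 ?_
    rw [CoeffSeq.iterInt_mul, CoeffSeq.iterInt_zero, CoeffSeq.conv_iterInt_self_inv]

/-- The weakest topology in which all basic iterated integrals are continuous. -/
instance : TopologicalSpace GX := ⨅ w : List ℕ+, TopologicalSpace.induced (iterInt w) inferInstance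

end GX

/-! ### Convergent power series tangent to the identity -/

/-- Complex power series `r + d₁ r² + d₂ r³ + ⋯` convergent in some neighbourhood of `0`. -/
@[ext] structure ConvSeries where
  series : PowerSeries ℂ
  coeff_zero : PowerSeries.coeff 0 series = 0
  coeff_one : PowerSeries.coeff 1 series = 1
  convergent : ∃ ρ : ℝ, 0 < ρ ∧ ∀ z : ℂ, ‖z‖ < ρ →
    Summable fun n : ℕ => PowerSeries.coeff n series * z ^ n

namespace ConvSeries

/-- The sum of the series. -/
def eval (f : ConvSeries) (z : ℂ) : ℂ := ∑' n : ℕ, PowerSeries.coeff n f.series * z ^ n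

/-- The functions `d_k`, `k ≥ 1`: the coefficient at `r ^ (k + 1)`. -/
def d (k : ℕ+) (f : ConvSeries) : ℂ := PowerSeries.coeff ((k : ℕ) + 1) f.series

theorem hasFPowerSeriesAt (f : ConvSeries) :
    HasFPowerSeriesAt f.eval
      (FormalMultilinearSeries.ofScalars ℂ fun n => PowerSeries.coeff n f.series) 0 := by
  set p := FormalMultilinearSeries.ofScalars ℂ (fun n => PowerSeries.coeff n f.series) with hp
  obtain ⟨ρ, hρ, h⟩ := f.convergent
  have hs : Summable fun n : ℕ => ‖p n‖ * ((⟨ρ / 2, by positivity⟩ : NNReal) : ℝ) ^ n := by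
    have h1 := (h ((ρ / 2 : ℝ) : ℂ) (by
      rw [Complex.norm_real, Real.norm_of_nonneg (by positivity)]; linarith)).norm
    refine h1.congr fun n => ?_
    rw [hp, FormalMultilinearSeries.ofScalars_norm, norm_mul, norm_pow, Complex.norm_real,
      Real.norm_of_nonneg (by positivity)]
  have hr : 0 < p.radius := lt_of_lt_of_le
    (ENNReal.coe_pos.2 (show (0 : ℝ) < ρ / 2 by positivity)) (p.le_radius_of_summable hs)
  have h2 := (p.hasFPowerSeriesOnBall hr).hasFPowerSeriesAt
  have h3 : f.eval = p.sum := by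
    funext z
    simp [eval, FormalMultilinearSeries.sum, hp, mul_comm]
  rwa [h3]

theorem analyticAt_eval (f : ConvSeries) : AnalyticAt ℂ f.eval 0 := ⟨_, f.hasFPowerSeriesAt⟩

theorem eval_zero (f : ConvSeries) : f.eval 0 = 0 := by
  have := f.hasFPowerSeriesAt.coeff_zero (fun _ => 0)
  simpa [f.coeff_zero] using this.symm

theorem deriv_eval (f : ConvSeries) : deriv f.eval 0 = 1 := by
  rw [f.hasFPowerSeriesAt.deriv]
  simp [f.coeff_one]

theorem ext_of_eventuallyEq {f g : ConvSeries} (h : f.eval =ᶠ[𝓝 0] g.eval) : f = g := by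
  have h1 := (f.hasFPowerSeriesAt.congr h).eq_formalMultilinearSeries g.hasFPowerSeriesAt
  ext n
  have := congrArg (fun p => FormalMultilinearSeries.coeff p n) h1
  simpa using this

/-- The Taylor series at `0` of a function analytic at `0` and tangent to the identity. -/
def ofAnalytic (h : ℂ → ℂ) (ha : AnalyticAt ℂ h 0) (h0 : h 0 = 0) (h1 : deriv h 0 = 1) :
    ConvSeries where
  series := PowerSeries.mk fun n => iteratedDeriv n h 0 / (n.factorial : ℂ)
  coeff_zero := by simp [h0]
  coeff_one := by simp [h1]
  convergent := by
    obtain ⟨r, hr⟩ := ha.hasFPowerSeriesAt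
    refine ⟨(min r 1).toReal,
      ENNReal.toReal_pos (lt_min hr.r_pos one_pos).ne' (by simp), fun z hz => ?_⟩
    have hz2 : z ∈ Metric.eball (0 : ℂ) r := by
      rw [Metric.mem_eball, edist_zero_right]
      have : ENNReal.ofReal ‖z‖ < min r 1 := by
        rwa [ENNReal.ofReal_lt_iff_lt_toReal (norm_nonneg _) (by simp)]
      rw [ofReal_norm] at this
      exact this.trans_le (min_le_left _ _)
    simpa [mul_comm] using (hr.hasSum hz2).summable

theorem eval_ofAnalytic (h : ℂ → ℂ) (ha : AnalyticAt ℂ h 0) (h0 : h 0 = 0) (h1 : deriv h 0 = 1) :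
    (ofAnalytic h ha h0 h1).eval =ᶠ[𝓝 0] h := by
  filter_upwards [ha.hasFPowerSeriesAt.eventually_hasSum] with z hz
  rw [zero_add] at hz
  rw [← hz.tsum_eq]
  simp [eval, ofAnalytic, mul_comm]

/-- The composition `g ∘ f`: the Taylor series of `r ↦ g (f r)`. -/
def comp (g f : ConvSeries) : ConvSeries :=
  ofAnalytic (fun r => g.eval (f.eval r))
    ((by rw [f.eval_zero]; exact g.analyticAt_eval : AnalyticAt ℂ g.eval (f.eval 0)).comp
      f.analyticAt_eval)
    (by simp [f.eval_zero, g.eval_zero])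
    (by
      have hg : HasDerivAt g.eval 1 (f.eval 0) := by
        rw [f.eval_zero, ← g.deriv_eval]
        exact g.analyticAt_eval.differentiableAt.hasDerivAt
      have hf : HasDerivAt f.eval 1 0 := by
        rw [← f.deriv_eval]
        exact f.analyticAt_eval.differentiableAt.hasDerivAt
      have := (hg.comp 0 hf).deriv
      rw [one_mul] at this
      exact this)

theorem eval_comp (g f : ConvSeries) :
    (comp g f).eval =ᶠ[𝓝 0] fun r => g.eval (f.eval r) :=
  eval_ofAnalytic _ _ _ _

theorem tendsto_eval (f : ConvSeries) : Tendsto f.eval (𝓝 0) (𝓝 0) := by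
  simpa [f.eval_zero] using f.analyticAt_eval.continuousAt.tendsto

theorem comp_assoc (h g f : ConvSeries) : comp (comp h g) f = comp h (comp g f) := by
  apply ext_of_eventuallyEq
  filter_upwards [eval_comp (comp h g) f, eval_comp h (comp g f), eval_comp g f,
    f.tendsto_eval.eventually (eval_comp h g)] with r h1 h2 h3 h4
  rw [h1, h2, h3, h4]

/-- The series `r`. -/
def identity : ConvSeries :=
  ofAnalytic (fun r => r) analyticAt_id rfl (deriv_id 0)

theorem eval_identity : identity.eval =ᶠ[𝓝 0] fun r => r := eval_ofAnalytic _ _ _ _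

theorem comp_identity (f : ConvSeries) : comp f identity = f := by
  apply ext_of_eventuallyEq
  filter_upwards [eval_comp f identity, eval_identity] with r h1 h2
  rw [h1, h2]

theorem identity_comp (f : ConvSeries) : comp identity f = f := by
  apply ext_of_eventuallyEq
  filter_upwards [eval_comp identity f, f.tendsto_eval.eventually eval_identity] with r h1 h2
  rw [h1, h2]

theorem exists_comp_eq_identity (f : ConvSeries) : ∃ g : ConvSeries, comp f g = identity := by
  have hd : HasStrictDerivAt f.eval 1 0 := by
    rw [← f.deriv_eval]; exact f.analyticAt_eval.hasStrictDerivAt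
  set e : ℂ ≃L[ℂ] ℂ := ContinuousLinearEquiv.refl ℂ ℂ
  have hd' : HasFDerivAt f.eval (e : ℂ →L[ℂ] ℂ) 0 := by
    have := hd.hasDerivAt.hasFDerivAt
    have he : ContinuousLinearMap.toSpanSingleton ℂ (1 : ℂ) = (e : ℂ →L[ℂ] ℂ) := by
      ext; simp [e]
    rwa [he] at this
  have hc : ContDiffAt ℂ ⊤ f.eval 0 := f.analyticAt_eval.contDiffAt
  have htop : (⊤ : WithTop ℕ∞) ≠ 0 := by simp
  set g := hc.localInverse hd' htop with hg
  have hga : AnalyticAt ℂ g 0 := by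
    have := hc.to_localInverse hd' htop
    rw [f.eval_zero] at this
    exact this.analyticAt
  have hg0 : g 0 = 0 := by
    have := hc.localInverse_apply_image hd' htop
    rwa [f.eval_zero] at this
  have hright : ∀ᶠ y in 𝓝 (0 : ℂ), f.eval (g y) = y := by
    have := (hc.hasStrictFDerivAt' hd' htop).eventually_right_inverse
    rw [f.eval_zero] at this
    exact this
  have hg1 : deriv g 0 = 1 := by
    have h1 : HasDerivAt (fun y => f.eval (g y)) (1 * deriv g 0) 0 := by
      have h2 : HasDerivAt f.eval 1 (g 0) := by rw [hg0]; exact hd.hasDerivAt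
      exact h2.comp 0 hga.differentiableAt.hasDerivAt
    have h3 : HasDerivAt (fun y => f.eval (g y)) 1 0 :=
      (hasDerivAt_id (0 : ℂ)).congr_of_eventuallyEq hright
    simpa using h1.unique h3
  refine ⟨ofAnalytic g hga hg0 hg1, ext_of_eventuallyEq ?_⟩
  filter_upwards [eval_comp f (ofAnalytic g hga hg0 hg1), eval_identity,
    eval_ofAnalytic g hga hg0 hg1, hright] with r h1 h2 h3 h4
  rw [h1, h2, h3, h4]

/-- The multiplication defined by composition: `f * g` is the series `g ∘ f` (first `f`,
then `g`). -/
instance : Mul ConvSeries where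
  mul f g := comp g f

/-- The unit is the series `r`. -/
instance : One ConvSeries where
  one := identity

/-- The compositional inverse. -/
instance : Inv ConvSeries where
  inv f := Classical.choose (exists_comp_eq_identity f)

theorem mul_def (f g : ConvSeries) : f * g = comp g f := rfl

instance : Group ConvSeries where
  mul_assoc f g h := (comp_assoc h g f).symm
  one_mul f := comp_identity f
  mul_one f := identity_comp f
  inv_mul_cancel f := Classical.choose_spec (exists_comp_eq_identity f)

/-- The weakest topology in which all the functions `d_k` are continuous. -/
instance : TopologicalSpace ConvSeries := ⨅ k : ℕ+, TopologicalSpace.induced (d k) inferInstance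

end ConvSeries

/-! ### The first return map and the center set -/

/-- `v` is a Lipschitz solution on `[0, 2π]` of `v' = ∑ aᵢ(x) v ^ (i + 1)`, with the equation
satisfied almost everywhere, and initial value `v(0) = r`. -/
structure IsSolution (a : CoeffSeq) (r : ℂ) (v : ℝ → ℂ) : Prop where
  lipschitz : ∃ K : NNReal, LipschitzOnWith K v (Set.Icc 0 (2 * Real.pi))
  ode : ∀ᵐ x ∂(volume.restrict (Set.Ioo (0 : ℝ) (2 * Real.pi))),
    ∃ v' : ℂ, HasDerivAt v v' x ∧ HasSum (fun i : ℕ+ => a.coeff i x * v x ^ ((i : ℕ) + 1)) v'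
  init : v 0 = r

/-- The series `f` is the first return map of the equation: for all sufficiently small initial
values `r` there is a solution `v` on `[0, 2π]`, it is unique, and `v(2π) = f(r)`. -/
def IsFirstReturnMap (a : CoeffSeq) (f : ConvSeries) : Prop :=
  ∀ᶠ r in 𝓝 (0 : ℂ), ∃ v : ℝ → ℂ, IsSolution a r v ∧
    (∀ w : ℝ → ℂ, IsSolution a r w → Set.EqOn w v (Set.Icc 0 (2 * Real.pi))) ∧
    v (2 * Real.pi) = f.eval r

/-- The center set: for all sufficiently small initial values, the solution satisfies
`v(0) = v(2π)`. -/
def centerSet : Set CoeffSeq :=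
  {a | ∀ᶠ r in 𝓝 (0 : ℂ), ∃ v : ℝ → ℂ, IsSolution a r v ∧ v 0 = v (2 * Real.pi)}

/-- Every neighbourhood of every point contains an open neighbourhood of that point which is
simply connected (in particular arcwise connected). -/
def LocallySimplyConnected (Y : Type*) [TopologicalSpace Y] : Prop :=
  ∀ y : Y, ∀ U ∈ 𝓝 y, ∃ V : Set Y, IsOpen V ∧ y ∈ V ∧ V ⊆ U ∧ IsSimplyConnected V

end

end CenterProblem

namespace CenterProblem

noncomputable section

/-! ### `G(X)` is a topological group -/

namespace CoeffSeq

theorem continuous_conv {Y : Type*} [TopologicalSpace Y] {f g : Y → List ℕ+ → ℂ}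
    (hf : ∀ w, Continuous fun y => f y w) (hg : ∀ w, Continuous fun y => g y w) (w : List ℕ+) :
    Continuous fun y => conv (f y) (g y) w := by
  induction w generalizing f with
  | nil => exact (hf []).mul (hg [])
  | cons i w ih =>
    exact ((hf []).mul (hg (i :: w))).add (ih (f := fun y u => f y (i :: u)) fun u => hf (i :: u))

theorem continuous_conv_sub {Y : Type*} [TopologicalSpace Y] {f g : Y → List ℕ+ → ℂ}
    (w : List ℕ+) (hf : ∀ u : List ℕ+, u.length < w.length → Continuous fun y => f y u)
    (hg : ∀ u, Continuous fun y => g y u) :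
    Continuous fun y => conv (f y) (g y) w - f y w * g y [] := by
  induction w generalizing f with
  | nil => simpa [conv] using continuous_const
  | cons i w ih =>
    simp only [conv, add_sub_assoc]
    refine ((hf [] (by simp)).mul (hg (i :: w))).add
      (ih (f := fun y u => f y (i :: u)) fun u hu => hf (i :: u) ?_)
    simpa using hu

theorem continuous_of_conv_eq_convOne {Y : Type*} [TopologicalSpace Y] {f g : Y → List ℕ+ → ℂ}
    (hg : ∀ u, Continuous fun y => g y u) (hg1 : ∀ y, g y [] = 1)
    (h : ∀ y, conv (f y) (g y) = convOne) (w : List ℕ+) : Continuous fun y => f y w := by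
  induction hn : w.length using Nat.strong_induction_on generalizing w with
  | _ n ih =>
    have h1 := continuous_conv_sub (f := f) (g := g) w
      (fun u hu => ih u.length (hn ▸ hu) u rfl) hg
    have h2 : (fun y => f y w) =
        fun y => convOne w - (conv (f y) (g y) w - f y w * g y []) := by
      funext y
      simp [h, hg1]
    rw [h2]
    exact continuous_const.sub h1

end CoeffSeq

namespace GX

theorem continuous_iterInt (w : List ℕ+) : Continuous (iterInt w) :=
  continuous_iInf_dom (i := w) continuous_induced_dom

theorem continuous_iff {Y : Type*} [TopologicalSpace Y] {F : Y → GX} :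
    Continuous F ↔ ∀ w, Continuous fun y => iterInt w (F y) := by
  simp only [continuous_iInf_rng, continuous_induced_rng]
  rfl

theorem iterInt_nil (g : GX) : iterInt [] g = 1 := by
  obtain ⟨a⟩ := g
  simp [iterInt, CoeffSeq.iterInt, CoeffSeq.iterIntTo]

theorem iterInt_mul (g h : GX) :
    (fun w => iterInt w (g * h)) = CoeffSeq.conv (fun w => iterInt w h) (fun w => iterInt w g) := by
  obtain ⟨a⟩ := g
  obtain ⟨b⟩ := h
  exact CoeffSeq.iterInt_mul a b

theorem iterInt_one : (fun w => iterInt w 1) = CoeffSeq.convOne := CoeffSeq.iterInt_zero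

theorem ext_iterInt {g h : GX} (H : ∀ w, iterInt w g = iterInt w h) : g = h := by
  obtain ⟨a⟩ := g
  obtain ⟨b⟩ := h
  exact (mk_eq_mk_iff a b).2 (funext H)

instance : IsTopologicalGroup GX where
  continuous_mul := continuous_iff.2 fun w => by
    have : (fun p : GX × GX => iterInt w (p.1 * p.2)) =
        fun p => CoeffSeq.conv (fun w => iterInt w p.2) (fun w => iterInt w p.1) w := by
      funext p
      exact congrFun (iterInt_mul p.1 p.2) w
    rw [this]
    exact CoeffSeq.continuous_conv (f := fun (p : GX × GX) w => iterInt w p.2)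
      (g := fun (p : GX × GX) w => iterInt w p.1)
      (fun w => (continuous_iterInt w).comp continuous_snd)
      (fun w => (continuous_iterInt w).comp continuous_fst) w
  continuous_inv := continuous_iff.2 fun w =>
    CoeffSeq.continuous_of_conv_eq_convOne (f := fun (g : GX) w => iterInt w g⁻¹)
      (g := fun (g : GX) w => iterInt w g) continuous_iterInt iterInt_nil
      (fun g => by rw [← iterInt_mul, mul_inv_cancel, iterInt_one]) w

end GX

/-! ### The group of convergent series is a topological group -/

namespace ConvSeries

/-- The coefficient at `r ^ n`. -/
def co (n : ℕ) (f : ConvSeries) : ℂ := PowerSeries.coeff n f.series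

theorem co_zero (f : ConvSeries) : co 0 f = 0 := f.coeff_zero

theorem co_one (f : ConvSeries) : co 1 f = 1 := f.coeff_one

theorem ext_co {f g : ConvSeries} (h : ∀ n, co n f = co n g) : f = g :=
  ConvSeries.ext (PowerSeries.ext h)

theorem continuous_co (n : ℕ) : Continuous (co n) := by
  match n with
  | 0 => simpa only [funext co_zero] using continuous_const
  | 1 => simpa only [funext co_one] using continuous_const
  | n + 2 => exact continuous_iInf_dom (i := n.succPNat) continuous_induced_dom

theorem continuous_of_co {Y : Type*} [TopologicalSpace Y] {F : Y → ConvSeries}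
    (h : ∀ n, 2 ≤ n → Continuous fun y => co n (F y)) : Continuous F := by
  simp only [continuous_iInf_rng, continuous_induced_rng]
  exact fun k => h (k + 1) (by have := k.pos; omega)

theorem co_mul (f g : ConvSeries) (n : ℕ) :
    co n (f * g) = ∑ c : Composition n, co c.length g * ∏ i, co (c.blocksFun i) f := by
  have hg := g.hasFPowerSeriesAt
  rw [← f.eval_zero] at hg
  have h := (f * g).hasFPowerSeriesAt.eq_formalMultilinearSeries
    ((hg.comp f.hasFPowerSeriesAt).congr (eval_comp g f).symm)
  have h2 := congrArg (fun p => FormalMultilinearSeries.coeff p n) h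
  simp only [FormalMultilinearSeries.coeff_ofScalars] at h2
  refine h2.trans ?_
  simp only [FormalMultilinearSeries.coeff, FormalMultilinearSeries.comp,
    sum_apply, FormalMultilinearSeries.compAlongComposition_apply]
  refine Finset.sum_congr rfl fun c _ => ?_
  simp [FormalMultilinearSeries.ofScalars, FormalMultilinearSeries.applyComposition, co,
    List.prod_ofFn, Function.comp_def]

theorem co_one_series {n : ℕ} (hn : 2 ≤ n) : co n (1 : ConvSeries) = 0 := by
  have h := (1 : ConvSeries).hasFPowerSeriesAt.congr eval_identity
  have h2 := congrArg (fun p => FormalMultilinearSeries.coeff p n)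
    (h.eq_formalMultilinearSeries ((ContinuousLinearMap.id ℂ ℂ).hasFPowerSeriesAt 0))
  simp only [FormalMultilinearSeries.coeff_ofScalars] at h2
  refine h2.trans ?_
  obtain ⟨m, rfl⟩ := Nat.exists_eq_add_of_le' hn
  simp [FormalMultilinearSeries.coeff, ContinuousLinearMap.fpowerSeries]

theorem co_inv (f : ConvSeries) {n : ℕ} (hn : 2 ≤ n) :
    co n f⁻¹ = -∑ c ∈ Finset.univ.erase (Composition.ones n),
      co c.length f⁻¹ * ∏ i, co (c.blocksFun i) f := by
  have h := co_mul f f⁻¹ n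
  rw [mul_inv_cancel, co_one_series hn,
    ← Finset.add_sum_erase _ _ (Finset.mem_univ (Composition.ones n))] at h
  have h1 : ∏ i, co ((Composition.ones n).blocksFun i) f = 1 :=
    Finset.prod_eq_one fun i _ => by rw [Composition.ones_blocksFun, co_one]
  rw [h1, mul_one, Composition.ones_length] at h
  exact eq_neg_of_add_eq_zero_left h.symm

instance : IsTopologicalGroup ConvSeries where
  continuous_mul := continuous_of_co fun n _ => by
    simp only [co_mul]
    exact continuous_finsetSum _ fun c _ => ((continuous_co _).comp continuous_snd).mul
      (continuous_finsetProd _ fun i _ => (continuous_co _).comp continuous_fst)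
  continuous_inv := continuous_of_co fun n hn => by
    induction n using Nat.strong_induction_on with
    | _ n ih =>
      simp only [fun f => co_inv f hn]
      refine (continuous_finsetSum _ fun c hc => ?_).neg
      have hlt : c.length < n :=
        lt_of_le_of_ne c.length_le fun h =>
          (Finset.mem_erase.1 hc).1 (Composition.eq_ones_iff_length.2 h)
      refine Continuous.mul ?_ (continuous_finsetProd _ fun i _ => continuous_co _)
      rcases lt_or_ge c.length 2 with h2 | h2
      · interval_cases c.length
        · simpa only [co_zero] using continuous_const
        · simpa only [co_one] using continuous_const
      · exact ih _ hlt h2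

end ConvSeries

/-! ### The backward flow series -/

theorem norm_pow_succ_sub_le {ρ : ℝ} {z w : ℂ} (hz : ‖z‖ ≤ ρ) (hw : ‖w‖ ≤ ρ) (n : ℕ) :
    ‖z ^ (n + 1) - w ^ (n + 1)‖ ≤ (n + 1) * ρ ^ n * ‖z - w‖ := by
  have hρ : 0 ≤ ρ := (norm_nonneg z).trans hz
  induction n with
  | zero => simp
  | succ n ih =>
    have h : z ^ (n + 1 + 1) - w ^ (n + 1 + 1) =
        z * (z ^ (n + 1) - w ^ (n + 1)) + w ^ (n + 1) * (z - w) := by ring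
    rw [h]
    refine (norm_add_le _ _).trans ?_
    rw [norm_mul, norm_mul, norm_pow]
    calc ‖z‖ * ‖z ^ (n + 1) - w ^ (n + 1)‖ + ‖w‖ ^ (n + 1) * ‖z - w‖
        ≤ ρ * ((n + 1) * ρ ^ n * ‖z - w‖) + ρ ^ (n + 1) * ‖z - w‖ := by gcongr
      _ = _ := by push_cast; ring

/-- Termwise differentiation of a series of functions whose difference quotients at the point
are dominated by a summable sequence. -/
theorem hasDerivAt_tsum_of_norm_sub_le {f : ℕ → ℝ → ℂ} {f' : ℕ → ℂ} {K : ℕ → ℝ} {s : Set ℝ} {x : ℝ}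
    (hK : Summable K) (hs : s ∈ 𝓝 x) (hf : ∀ y ∈ s, Summable fun n => f n y)
    (hL : ∀ n, ∀ y ∈ s, ‖f n y - f n x‖ ≤ K n * |y - x|) (hd : ∀ n, HasDerivAt (f n) (f' n) x) :
    HasDerivAt (fun y => ∑' n, f n y) (∑' n, f' n) x := by
  rw [hasDerivAt_iff_tendsto_slope]
  have hs' : s ∈ 𝓝[≠] x := mem_nhdsWithin_of_mem_nhds hs
  have h := tendsto_tsum_of_dominated_convergence (𝓕 := 𝓝[≠] x)
    (f := fun y n => slope (f n) x y) hK (fun n => hasDerivAt_iff_tendsto_slope.1 (hd n)) (by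
      filter_upwards [hs', self_mem_nhdsWithin] with y hy hne n
      have hpos : 0 < |y - x| := abs_pos.2 (sub_ne_zero.2 hne)
      rw [slope_def_module, norm_smul, norm_inv, Real.norm_eq_abs, inv_mul_le_iff₀ hpos, mul_comm]
      exact hL n y hy)
  refine h.congr' ?_
  filter_upwards [hs'] with y hy
  simp only [slope_def_module]
  rw [tsum_const_smul'', (hf y hy).tsum_sub (hf x (mem_of_mem_nhds hs))]

namespace CoeffSeq

/-- The coefficient `a_{k+1}`. -/
def nth (a : CoeffSeq) (k : ℕ) : ℝ → ℂ := a.coeff k.succPNat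

theorem exists_norm_nth_le (a : CoeffSeq) :
    ∃ l : ℝ, 0 < l ∧ ∀ k x, ‖a.nth k x‖ ≤ l ^ (k + 1) := by
  obtain ⟨l, hl, h⟩ := a.bound_coeff
  exact ⟨l, hl, fun k x => h _ x⟩

/-- The coefficients of the series `∑ qₘ(x) z ^ (m + 1)` expressing the value at `0` of the
solution that takes the value `z` at `x`. -/
def backCoeff (a : CoeffSeq) : ℕ → ℝ → ℂ
  | 0, _ => 1
  | m + 1, x => ∫ s in (0 : ℝ)..x,
      -∑ j : Fin (m + 1), ((j : ℕ) + 1 : ℂ) * backCoeff a j s * a.nth (m - j) s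
  decreasing_by exact j.2

/-- The derivative of `backCoeff a (m + 1)`. -/
def backDeriv (a : CoeffSeq) (m : ℕ) (s : ℝ) : ℂ :=
  -∑ p ∈ Finset.HasAntidiagonal.antidiagonal m, (p.1 + 1 : ℂ) * backCoeff a p.1 s * a.nth p.2 s

theorem backCoeff_zero (a : CoeffSeq) (x : ℝ) : backCoeff a 0 x = 1 := by rw [backCoeff]

theorem backCoeff_succ (a : CoeffSeq) (m : ℕ) (x : ℝ) :
    backCoeff a (m + 1) x = ∫ s in (0 : ℝ)..x, backDeriv a m s := by
  rw [backCoeff]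
  congr 1
  funext s
  rw [backDeriv, Finset.Nat.sum_antidiagonal_eq_sum_range_succ
    (fun i j => (i + 1 : ℂ) * backCoeff a i s * a.nth j s), Finset.sum_range]

theorem intervalIntegrable_nth (a : CoeffSeq) (k : ℕ) (x y : ℝ) :
    IntervalIntegrable (a.nth k) volume x y := intervalIntegrable_coeff a _ x y

theorem intervalIntegrable_backDeriv_of (a : CoeffSeq) (m : ℕ)
    (h : ∀ j ≤ m, Continuous (backCoeff a j)) (x y : ℝ) :
    IntervalIntegrable (backDeriv a m) volume x y := by
  have hsum := (IntervalIntegrable.sum (f := fun (p : ℕ × ℕ) s =>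
    (p.1 + 1 : ℂ) * backCoeff a p.1 s * a.nth p.2 s) (Finset.HasAntidiagonal.antidiagonal m)
    fun p hp => (intervalIntegrable_nth a p.2 x y).continuousOn_mul
      (continuous_const.mul (h p.1 (Finset.HasAntidiagonal.mem_antidiagonal.1 hp ▸
        Nat.le_add_right _ _))).continuousOn).neg
  refine hsum.congr fun s _ => ?_
  simp [backDeriv]

theorem continuous_backCoeff (a : CoeffSeq) (m : ℕ) : Continuous (backCoeff a m) := by
  induction m using Nat.strong_induction_on with
  | _ m ih =>
    cases m with
    | zero => simpa only [funext (backCoeff_zero a)] using continuous_const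
    | succ m =>
      rw [funext (backCoeff_succ a m)]
      exact intervalIntegral.continuous_primitive
        (intervalIntegrable_backDeriv_of a m fun j hj => ih j (Nat.lt_succ_of_le hj)) 0

theorem intervalIntegrable_backDeriv (a : CoeffSeq) (m : ℕ) (x y : ℝ) :
    IntervalIntegrable (backDeriv a m) volume x y :=
  intervalIntegrable_backDeriv_of a m (fun j _ => continuous_backCoeff a j) x y

theorem ae_hasDerivAt_backCoeff (a : CoeffSeq) :
    ∀ᵐ x : ℝ, ∀ m, HasDerivAt (backCoeff a (m + 1)) (backDeriv a m x) x := by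
  rw [ae_all_iff]
  intro m
  have h : LocallyIntegrable (backDeriv a m) volume := by
    refine locallyIntegrable_iff.2 fun k hk => ?_
    obtain ⟨R, hR⟩ := hk.isBounded.subset_closedBall 0
    rw [Real.closedBall_eq_Icc] at hR
    rcases le_or_gt (0 - R) (0 + R) with hle | hlt
    · exact ((intervalIntegrable_iff_integrableOn_Icc_of_le hle).1
        (intervalIntegrable_backDeriv a m _ _)).mono_set hR
    · rw [Set.Icc_eq_empty hlt.not_ge] at hR
      rw [Set.subset_empty_iff.1 hR]
      exact integrableOn_empty
  filter_upwards [LocallyIntegrable.ae_hasDerivAt_integral h] with x hx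
  rw [funext (backCoeff_succ a m)]
  exact hx 0

theorem norm_backDeriv_le_of {a : CoeffSeq} {l B s : ℝ} (hl : 0 < l) (hB : 2 * l ≤ B)
    (ha : ∀ k x, ‖a.nth k x‖ ≤ l ^ (k + 1)) {m : ℕ}
    (h : ∀ j ≤ m, ‖backCoeff a j s‖ ≤ B ^ j) : ‖backDeriv a m s‖ ≤ (m + 1) * B ^ (m + 1) := by
  have hB0 : 0 < B := by linarith
  have h1 : ∀ p ∈ Finset.HasAntidiagonal.antidiagonal m,
      ‖(p.1 + 1 : ℂ) * backCoeff a p.1 s * a.nth p.2 s‖ ≤ (m + 1) * B ^ (m + 1) * (1 / 2 / 2 ^ p.2) := by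
    intro p hp
    have hp' := Finset.HasAntidiagonal.mem_antidiagonal.1 hp
    have h2 : ‖(p.1 + 1 : ℂ)‖ = p.1 + 1 := by
      rw [← Nat.cast_succ, Complex.norm_natCast, Nat.cast_succ]
    have h4 : p.1 ≤ m := hp' ▸ Nat.le_add_right _ _
    have h3 : (p.1 : ℝ) ≤ m := by exact_mod_cast h4
    rw [norm_mul, norm_mul, h2]
    calc (p.1 + 1 : ℝ) * ‖backCoeff a p.1 s‖ * ‖a.nth p.2 s‖
        ≤ (m + 1) * B ^ p.1 * (B / 2) ^ (p.2 + 1) := by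
          gcongr
          · exact h _ h4
          · refine (ha _ _).trans ?_
            gcongr
            linarith
      _ = _ := by
          rw [← hp', div_pow]
          field_simp
          ring
  rw [backDeriv, norm_neg]
  refine (norm_sum_le_of_le _ h1).trans ?_
  rw [← Finset.mul_sum]
  refine mul_le_of_le_one_right (by positivity) ?_
  rw [Finset.Nat.sum_antidiagonal_eq_sum_range_succ (fun _ j => (1 / 2 / 2 ^ j : ℝ))]
  refine (Finset.sum_range_reflect (fun j => (1 / 2 / 2 ^ j : ℝ)) (m + 1)).trans_le ?_
  exact ((summable_geometric_two' 1).sum_le_tsum _ fun _ _ => by positivity).trans_eq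
    (tsum_geometric_two' 1)

theorem norm_backCoeff_le {a : CoeffSeq} {l : ℝ} (hl : 0 < l)
    (ha : ∀ k x, ‖a.nth k x‖ ≤ l ^ (k + 1)) (m : ℕ) {x : ℝ} (hx : 0 ≤ x) :
    ‖backCoeff a m x‖ ≤ (2 * l * Real.exp x) ^ m := by
  induction m using Nat.strong_induction_on generalizing x with
  | _ m ih =>
    cases m with
    | zero => simp [backCoeff_zero]
    | succ m =>
      have hd : ∀ s : ℝ, HasDerivAt (fun s => (2 * l * Real.exp s) ^ (m + 1))
          ((m + 1) * (2 * l * Real.exp s) ^ (m + 1)) s := fun s => by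
        have := (((Real.hasDerivAt_exp s).const_mul (2 * l)).pow (m + 1))
        refine this.congr_deriv ?_
        push_cast
        rw [pow_succ, mul_assoc]
      have hcont : Continuous fun s : ℝ => (m + 1) * (2 * l * Real.exp s) ^ (m + 1) := by fun_prop
      rw [backCoeff_succ]
      refine (intervalIntegral.norm_integral_le_of_norm_le (g := fun s : ℝ =>
        (m + 1) * (2 * l * Real.exp s) ^ (m + 1)) hx (Eventually.of_forall fun s hs => ?_)
        (hcont.intervalIntegrable _ _)).trans ?_
      · refine norm_backDeriv_le_of hl ?_ ha fun j hj => ih j (Nat.lt_succ_of_le hj) hs.1.le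
        exact le_mul_of_one_le_right (by positivity) (Real.one_le_exp hs.1.le)
      · rw [intervalIntegral.integral_eq_sub_of_hasDerivAt (fun s _ => hd s)
          (hcont.intervalIntegrable _ _)]
        exact sub_le_self _ (by positivity)

/-- Geometric bounds for the coefficients of the equation and of the backward flow series on
`[0, 2π]`. -/
structure GeomBound (a : CoeffSeq) (C : ℝ) : Prop where
  pos : 0 < C
  nth_le : ∀ k x, ‖a.nth k x‖ ≤ C ^ (k + 1)
  coeff_le : ∀ m, ∀ x ∈ Set.Icc (0 : ℝ) (2 * Real.pi), ‖backCoeff a m x‖ ≤ C ^ m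
  deriv_le : ∀ m, ∀ x ∈ Set.Icc (0 : ℝ) (2 * Real.pi),
    ‖backDeriv a m x‖ ≤ (m + 1) * C ^ (m + 1)

theorem exists_geomBound (a : CoeffSeq) : ∃ C, GeomBound a C := by
  obtain ⟨l, hl, ha⟩ := a.exists_norm_nth_le
  have h1 : 1 ≤ Real.exp (2 * Real.pi) := Real.one_le_exp Real.two_pi_pos.le
  have h2 : 2 * l ≤ 2 * l * Real.exp (2 * Real.pi) := le_mul_of_one_le_right (by positivity) h1
  have h3 : ∀ m, ∀ x ∈ Set.Icc (0 : ℝ) (2 * Real.pi),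
      ‖backCoeff a m x‖ ≤ (2 * l * Real.exp (2 * Real.pi)) ^ m := fun m x hx => by
    refine (norm_backCoeff_le hl ha m hx.1).trans ?_
    gcongr
    exact hx.2
  exact ⟨2 * l * Real.exp (2 * Real.pi), by positivity, fun k x => (ha k x).trans (by
    gcongr; linarith), h3, fun m x hx => norm_backDeriv_le_of hl h2 ha fun j _ => h3 j x hx⟩

namespace GeomBound

variable {a : CoeffSeq} {C ρ : ℝ}

theorem lipschitz (h : GeomBound a C) (m : ℕ) {x y : ℝ} (hx : x ∈ Set.Icc (0 : ℝ) (2 * Real.pi))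
    (hy : y ∈ Set.Icc (0 : ℝ) (2 * Real.pi)) :
    ‖backCoeff a m x - backCoeff a m y‖ ≤ m * C ^ m * |x - y| := by
  cases m with
  | zero => simp [backCoeff_zero]
  | succ m =>
    rw [backCoeff_succ, backCoeff_succ, intervalIntegral.integral_interval_sub_left
      (intervalIntegrable_backDeriv a m _ _) (intervalIntegrable_backDeriv a m _ _)]
    push_cast
    refine intervalIntegral.norm_integral_le_of_norm_le_const fun s hs => h.deriv_le m s ?_
    exact Set.uIcc_subset_Icc hy hx (Set.uIoc_subset_uIcc hs)

/-- The comparison of the series with a geometric one on discs of radius at most `1 / (8 C)`. -/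
theorem mul_pow_le (h : GeomBound a C) (hρ : 0 ≤ ρ) (hC : C * ρ ≤ 1 / 8) (m : ℕ) :
    (m + 1) * (C ^ m * ρ ^ m) ≤ (1 / 4 : ℝ) ^ m := by
  have h1 : ((m + 1 : ℕ) : ℝ) ≤ 2 ^ m := by exact_mod_cast Nat.lt_two_pow_self (n := m)
  push_cast at h1
  calc (m + 1) * (C ^ m * ρ ^ m) = (m + 1) * (C * ρ) ^ m := by rw [mul_pow]
    _ ≤ 2 ^ m * (1 / 8) ^ m := by
      have := h.pos
      gcongr
    _ = _ := by rw [← mul_pow]; norm_num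

theorem norm_term_le (h : GeomBound a C) (hρ : 0 ≤ ρ) (hC : C * ρ ≤ 1 / 8) {x : ℝ}
    (hx : x ∈ Set.Icc (0 : ℝ) (2 * Real.pi)) {z : ℂ} (hz : ‖z‖ ≤ ρ) (m : ℕ) :
    ‖(m + 1 : ℂ) * backCoeff a m x * z ^ m‖ ≤ (1 / 4 : ℝ) ^ m := by
  refine le_trans ?_ (h.mul_pow_le hρ hC m)
  have h2 : ‖(m + 1 : ℂ)‖ = m + 1 := by
    rw [← Nat.cast_succ, Complex.norm_natCast, Nat.cast_succ]
  have := h.pos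
  rw [norm_mul, norm_mul, h2, norm_pow, mul_assoc]
  gcongr
  exact h.coeff_le m x hx

end GeomBound

/-- The backward flow: the value at `0` of the solution that takes the value `z` at `x`. -/
def backSum (a : CoeffSeq) (x : ℝ) (z : ℂ) : ℂ := ∑' m, backCoeff a m x * z ^ (m + 1)

/-- The `z`-derivative of the backward flow. -/
def backSumDeriv (a : CoeffSeq) (x : ℝ) (z : ℂ) : ℂ :=
  ∑' m : ℕ, (m + 1 : ℂ) * backCoeff a m x * z ^ m

namespace GeomBound

variable {a : CoeffSeq} {C ρ : ℝ}

theorem summable_geom : Summable fun m : ℕ => (1 / 4 : ℝ) ^ m :=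
  summable_geometric_of_lt_one (by norm_num) (by norm_num)

theorem summable_norm_deriv (h : GeomBound a C) (hρ : 0 ≤ ρ) (hC : C * ρ ≤ 1 / 8) {x : ℝ}
    (hx : x ∈ Set.Icc (0 : ℝ) (2 * Real.pi)) {z : ℂ} (hz : ‖z‖ ≤ ρ) :
    Summable fun m : ℕ => ‖(m + 1 : ℂ) * backCoeff a m x * z ^ m‖ :=
  Summable.of_nonneg_of_le (fun _ => norm_nonneg _) (h.norm_term_le hρ hC hx hz) summable_geom

theorem summable (h : GeomBound a C) (hρ : 0 ≤ ρ) (hC : C * ρ ≤ 1 / 8) {x : ℝ}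
    (hx : x ∈ Set.Icc (0 : ℝ) (2 * Real.pi)) {z : ℂ} (hz : ‖z‖ ≤ ρ) :
    Summable fun m => backCoeff a m x * z ^ (m + 1) := by
  refine Summable.of_norm_bounded (summable_geom.mul_left ρ) fun m => ?_
  have h0 := h.pos
  have h1 := h.mul_pow_le hρ hC m
  rw [norm_mul, norm_pow, pow_succ]
  calc ‖backCoeff a m x‖ * (‖z‖ ^ m * ‖z‖) ≤ C ^ m * (ρ ^ m * ρ) := by
        gcongr
        exact h.coeff_le m x hx
    _ ≤ (m + 1) * (C ^ m * (ρ ^ m * ρ)) :=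
        le_mul_of_one_le_left (by positivity) (by simp)
    _ = ρ * ((m + 1) * (C ^ m * ρ ^ m)) := by ring
    _ ≤ _ := by gcongr

theorem summable_norm_rhs (h : GeomBound a C) (hρ : 0 ≤ ρ) (hC : C * ρ ≤ 1 / 8) (x : ℝ)
    {z : ℂ} (hz : ‖z‖ ≤ ρ) : Summable fun k => ‖a.nth k x * z ^ (k + 2)‖ := by
  refine Summable.of_nonneg_of_le (fun _ => norm_nonneg _) (fun k => ?_)
    (summable_geom.mul_left (C * ρ ^ 2))
  have h0 := h.pos
  have h1 := h.mul_pow_le hρ hC k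
  rw [norm_mul, norm_pow]
  calc ‖a.nth k x‖ * ‖z‖ ^ (k + 2) ≤ C ^ (k + 1) * ρ ^ (k + 2) := by
        gcongr
        exact h.nth_le k x
    _ = C * ρ ^ 2 * (C ^ k * ρ ^ k) := by ring
    _ ≤ C * ρ ^ 2 * ((k + 1) * (C ^ k * ρ ^ k)) := by
        refine mul_le_mul_of_nonneg_left ?_ (by positivity)
        exact le_mul_of_one_le_left (by positivity) (by simp)
    _ ≤ _ := by gcongr

/-- Joint Lipschitz bound for the terms of the backward flow series. -/
theorem norm_term_sub_le (h : GeomBound a C) (hρ : 0 ≤ ρ) (hC : C * ρ ≤ 1 / 8) {x y : ℝ}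
    (hx : x ∈ Set.Icc (0 : ℝ) (2 * Real.pi)) (hy : y ∈ Set.Icc (0 : ℝ) (2 * Real.pi))
    {z w : ℂ} (hz : ‖z‖ ≤ ρ) (hw : ‖w‖ ≤ ρ) (m : ℕ) :
    ‖backCoeff a m x * z ^ (m + 1) - backCoeff a m y * w ^ (m + 1)‖ ≤
      (1 / 4 : ℝ) ^ m * (ρ * |x - y| + ‖z - w‖) := by
  have h0 := h.pos
  have h1 := h.mul_pow_le hρ hC m
  have h2 : backCoeff a m x * z ^ (m + 1) - backCoeff a m y * w ^ (m + 1) =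
      (backCoeff a m x - backCoeff a m y) * z ^ (m + 1) +
        backCoeff a m y * (z ^ (m + 1) - w ^ (m + 1)) := by ring
  rw [h2]
  refine (norm_add_le _ _).trans ?_
  rw [norm_mul, norm_mul, norm_pow]
  calc ‖backCoeff a m x - backCoeff a m y‖ * ‖z‖ ^ (m + 1) +
        ‖backCoeff a m y‖ * ‖z ^ (m + 1) - w ^ (m + 1)‖
      ≤ (m + 1) * C ^ m * |x - y| * ρ ^ (m + 1) + C ^ m * ((m + 1) * ρ ^ m * ‖z - w‖) := by
        gcongr
        · refine (h.lipschitz m hx hy).trans ?_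
          gcongr
          linarith
        · exact h.coeff_le m y hy
        · exact norm_pow_succ_sub_le hz hw m
    _ = (m + 1) * (C ^ m * ρ ^ m) * (ρ * |x - y| + ‖z - w‖) := by ring
    _ ≤ _ := by gcongr

theorem norm_backSum_sub_le (h : GeomBound a C) (hρ : 0 ≤ ρ) (hC : C * ρ ≤ 1 / 8) {x y : ℝ}
    (hx : x ∈ Set.Icc (0 : ℝ) (2 * Real.pi)) (hy : y ∈ Set.Icc (0 : ℝ) (2 * Real.pi))
    {z w : ℂ} (hz : ‖z‖ ≤ ρ) (hw : ‖w‖ ≤ ρ) :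
    ‖backSum a x z - backSum a y w‖ ≤ 2 * (ρ * |x - y| + ‖z - w‖) := by
  rw [backSum, backSum, ← (h.summable hρ hC hx hz).tsum_sub (h.summable hρ hC hy hw)]
  refine (tsum_of_norm_bounded (summable_geom.mul_right _).hasSum
    (h.norm_term_sub_le hρ hC hx hy hz hw)).trans ?_
  rw [tsum_mul_right, tsum_geometric_of_lt_one (by norm_num) (by norm_num)]
  gcongr
  norm_num

theorem norm_backSum_sub_sub_le (h : GeomBound a C) (hρ : 0 ≤ ρ) (hC : C * ρ ≤ 1 / 8) {x : ℝ}
    (hx : x ∈ Set.Icc (0 : ℝ) (2 * Real.pi)) {z w : ℂ} (hz : ‖z‖ ≤ ρ) (hw : ‖w‖ ≤ ρ) :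
    ‖(backSum a x z - z) - (backSum a x w - w)‖ ≤ 1 / 2 * ‖z - w‖ := by
  have h1 := h.summable hρ hC hx hz
  have h2 := h.summable hρ hC hx hw
  rw [backSum, backSum, h1.tsum_eq_zero_add, h2.tsum_eq_zero_add]
  simp only [backCoeff_zero, zero_add, pow_one, one_mul, add_sub_cancel_left]
  rw [← ((summable_nat_add_iff 1).2 h1).tsum_sub ((summable_nat_add_iff 1).2 h2)]
  have h3 : ∀ m, ‖backCoeff a (m + 1) x * z ^ (m + 1 + 1) -
      backCoeff a (m + 1) x * w ^ (m + 1 + 1)‖ ≤ (1 / 4 : ℝ) ^ m * (1 / 4 * ‖z - w‖) := fun m => by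
    refine (h.norm_term_sub_le hρ hC hx hx hz hw (m + 1)).trans_eq ?_
    simp
    ring
  refine (tsum_of_norm_bounded (summable_geom.mul_right _).hasSum h3).trans ?_
  rw [tsum_mul_right, tsum_geometric_of_lt_one (by norm_num) (by norm_num)]
  linarith [norm_nonneg (z - w)]

theorem norm_sub_le_two_mul (h : GeomBound a C) (hρ : 0 ≤ ρ) (hC : C * ρ ≤ 1 / 8) {x : ℝ}
    (hx : x ∈ Set.Icc (0 : ℝ) (2 * Real.pi)) {z w : ℂ} (hz : ‖z‖ ≤ ρ) (hw : ‖w‖ ≤ ρ) :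
    ‖z - w‖ ≤ 2 * ‖backSum a x z - backSum a x w‖ := by
  have h1 := h.norm_backSum_sub_sub_le hρ hC hx hz hw
  have h2 : z - w = (backSum a x z - backSum a x w) -
      ((backSum a x z - z) - (backSum a x w - w)) := by ring
  have h3 := norm_sub_le (backSum a x z - backSum a x w)
      ((backSum a x z - z) - (backSum a x w - w))
  rw [← h2] at h3
  linarith

theorem backSumDeriv_ne_zero (h : GeomBound a C) (hρ : 0 ≤ ρ) (hC : C * ρ ≤ 1 / 8) {x : ℝ}
    (hx : x ∈ Set.Icc (0 : ℝ) (2 * Real.pi)) {z : ℂ} (hz : ‖z‖ ≤ ρ) : backSumDeriv a x z ≠ 0 := by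
  intro h0
  have h1 := (h.summable_norm_deriv hρ hC hx hz).of_norm
  rw [backSumDeriv, h1.tsum_eq_zero_add] at h0
  have h2 : ∀ m : ℕ, ‖((m + 1 : ℕ) + 1 : ℂ) * backCoeff a (m + 1) x * z ^ (m + 1)‖ ≤
      (1 / 4 : ℝ) ^ m * (1 / 4) := fun m => h.norm_term_le hρ hC hx hz (m + 1)
  have h3 := tsum_of_norm_bounded (summable_geom.mul_right _).hasSum h2
  rw [tsum_mul_right, tsum_geometric_of_lt_one (by norm_num) (by norm_num)] at h3
  simp only [backCoeff_zero, Nat.cast_zero, zero_add, pow_zero, mul_one] at h0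
  rw [← neg_eq_of_add_eq_zero_right h0] at h3
  norm_num at h3

theorem hasDerivAt_backSum (h : GeomBound a C) (hρ : 0 ≤ ρ) (hC : C * ρ ≤ 1 / 8) {x T K : ℝ}
    (hT : T ≤ 2 * Real.pi) (hx : x ∈ Set.Ioo 0 T) {w : ℝ → ℂ} {w' : ℂ}
    (hK : ∀ y ∈ Set.Icc 0 T, ‖w y - w x‖ ≤ K * |y - x|) (hw : ∀ y ∈ Set.Icc 0 T, ‖w y‖ ≤ ρ)
    (hd : HasDerivAt w w' x) (hq : ∀ m, HasDerivAt (backCoeff a (m + 1)) (backDeriv a m x) x) :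
    HasDerivAt (fun y => backSum a y (w y))
      (backSumDeriv a x (w x) * (w' - ∑' k, a.nth k x * w x ^ (k + 2))) x := by
  have hsub : ∀ y ∈ Set.Icc 0 T, y ∈ Set.Icc (0 : ℝ) (2 * Real.pi) :=
    fun y hy => ⟨hy.1, hy.2.trans hT⟩
  have hxI : x ∈ Set.Icc 0 T := Set.Ioo_subset_Icc_self hx
  have hS := h.summable_norm_deriv hρ hC (hsub x hxI) (hw x hxI)
  have hR := h.summable_norm_rhs hρ hC x (hw x hxI)
  have hterm : ∀ m, HasDerivAt (fun y => backCoeff a m y * w y ^ (m + 1))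
      ((match m with | 0 => 0 | m + 1 => backDeriv a m x * w x ^ (m + 2)) +
        (m + 1 : ℂ) * backCoeff a m x * w x ^ m * w') x := by
    intro m
    have hp := hd.pow (m + 1)
    rw [Nat.add_sub_cancel] at hp
    cases m with
    | zero => simpa [backCoeff_zero] using hd
    | succ m =>
      refine ((hq m).mul hp).congr_deriv ?_
      push_cast
      simp only [Pi.pow_apply]
      ring
  have hmain := hasDerivAt_tsum_of_norm_sub_le (K := fun m => (1 / 4 : ℝ) ^ m * (ρ + K))
    (summable_geom.mul_right _) (Icc_mem_nhds hx.1 hx.2)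
    (fun y hy => h.summable hρ hC (hsub y hy) (hw y hy)) (fun m y hy => by
      refine (h.norm_term_sub_le hρ hC (hsub y hy) (hsub x hxI) (hw y hy) (hw x hxI) m).trans ?_
      rw [mul_assoc, add_mul]
      gcongr
      exact hK y hy) hterm
  refine hmain.congr_deriv ?_
  have hprod : ∀ m, backDeriv a m x * w x ^ (m + 2) = -∑ p ∈ Finset.HasAntidiagonal.antidiagonal m,
      ((p.1 + 1 : ℂ) * backCoeff a p.1 x * w x ^ p.1) * (a.nth p.2 x * w x ^ (p.2 + 2)) := by
    intro m
    rw [backDeriv, neg_mul, Finset.sum_mul]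
    congr 1
    refine Finset.sum_congr rfl fun p hp => ?_
    rw [← Finset.HasAntidiagonal.mem_antidiagonal.1 hp]
    ring
  have hsum1 : Summable fun m => backDeriv a m x * w x ^ (m + 2) := by
    simp only [hprod]
    exact (summable_norm_sum_mul_antidiagonal_of_summable_norm hS hR).of_norm.neg
  have hsum0 : Summable fun m : ℕ =>
      (match m with | 0 => (0 : ℂ) | m + 1 => backDeriv a m x * w x ^ (m + 2)) :=
    (summable_nat_add_iff 1).1 hsum1
  rw [hsum0.tsum_add (hS.of_norm.mul_right w'), hsum0.tsum_eq_zero_add, tsum_mul_right]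
  simp only [zero_add, hprod]
  rw [tsum_neg, ← tsum_mul_tsum_eq_tsum_sum_antidiagonal_of_summable_norm hS hR, backSumDeriv]
  ring

end GeomBound

end CoeffSeq

/-! ### Solutions and the backward flow -/

namespace CoeffSeq

theorem hasSum_coeff_iff (a : CoeffSeq) (x : ℝ) (z v' : ℂ) :
    HasSum (fun i : ℕ+ => a.coeff i x * z ^ ((i : ℕ) + 1)) v' ↔
      HasSum (fun k => a.nth k x * z ^ (k + 2)) v' :=
  (Equiv.pnatEquivNat.symm.hasSum_iff (f := fun i : ℕ+ => a.coeff i x * z ^ ((i : ℕ) + 1))).symm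

theorem backSum_zero_left (a : CoeffSeq) (z : ℂ) : backSum a 0 z = z := by
  rw [backSum, tsum_eq_single 0]
  · simp [backCoeff_zero]
  · rintro (_ | m) hm
    · exact absurd rfl hm
    · simp [backCoeff_succ]

theorem backSum_zero_right (a : CoeffSeq) (x : ℝ) : backSum a x 0 = 0 := by
  simp [backSum]

namespace GeomBound

variable {a : CoeffSeq} {C ρ : ℝ}

theorem norm_le_two_mul (h : GeomBound a C) (hρ : 0 ≤ ρ) (hC : C * ρ ≤ 1 / 8) {x : ℝ}
    (hx : x ∈ Set.Icc (0 : ℝ) (2 * Real.pi)) {z : ℂ} (hz : ‖z‖ ≤ ρ) :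
    ‖z‖ ≤ 2 * ‖backSum a x z‖ := by
  simpa [backSum_zero_right] using
    h.norm_sub_le_two_mul hρ hC hx hz (w := 0) (by simpa using hρ)

/-- The backward flow sends the values of a small solution to its initial value. -/
theorem backSum_eq_of_isSolution (h : GeomBound a C) (hρ : 0 ≤ ρ) (hC : C * ρ ≤ 1 / 8) {T : ℝ}
    (hT : T ∈ Set.Icc (0 : ℝ) (2 * Real.pi)) {r : ℂ} {w : ℝ → ℂ} (hw : IsSolution a r w)
    (hb : ∀ y ∈ Set.Icc 0 T, ‖w y‖ ≤ ρ) : backSum a T (w T) = r := by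
  obtain ⟨K, hK⟩ := hw.lipschitz
  have hsub : ∀ y ∈ Set.Icc 0 T, y ∈ Set.Icc (0 : ℝ) (2 * Real.pi) :=
    fun y hy => ⟨hy.1, hy.2.trans hT.2⟩
  have hKw : ∀ x ∈ Set.Icc 0 T, ∀ y ∈ Set.Icc 0 T, ‖w y - w x‖ ≤ K * |y - x| :=
    fun x hx y hy => by
      simpa [dist_eq_norm] using hK.dist_le_mul y (hsub y hy) x (hsub x hx)
  have hlip : LipschitzOnWith (2 * (ρ.toNNReal + K)) (fun y => backSum a y (w y))
      (Set.uIcc 0 T) := by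
    rw [Set.uIcc_of_le hT.1]
    refine LipschitzOnWith.of_dist_le_mul fun x hx y hy => ?_
    rw [dist_eq_norm, Real.dist_eq]
    refine (h.norm_backSum_sub_le hρ hC (hsub x hx) (hsub y hy) (hb x hx) (hb y hy)).trans ?_
    have := hKw y hy x hx
    push_cast
    rw [Real.coe_toNNReal _ hρ, mul_assoc, add_mul]
    gcongr
  have hae : ∀ᵐ x : ℝ, x ∈ Set.uIcc 0 T → HasDerivAt (fun y => backSum a y (w y)) 0 x := by
    have hode := (ae_restrict_iff' measurableSet_Ioo).1 hw.ode
    have h0 : ∀ᵐ x : ℝ, x ≠ 0 := by simp [ae_iff, measure_singleton]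
    have h1 : ∀ᵐ x : ℝ, x ≠ T := by simp [ae_iff, measure_singleton]
    filter_upwards [hode, h0, h1, ae_hasDerivAt_backCoeff a] with x hx hx0 hxT hq hxI
    rw [Set.uIcc_of_le hT.1] at hxI
    have hxo : x ∈ Set.Ioo 0 T := ⟨lt_of_le_of_ne hxI.1 hx0.symm, lt_of_le_of_ne hxI.2 hxT⟩
    obtain ⟨v', hv', hs⟩ := hx ⟨hxo.1, hxo.2.trans_le hT.2⟩
    have hd := h.hasDerivAt_backSum hρ hC hT.2 hxo (hKw x hxI) hb hv' hq
    rwa [((hasSum_coeff_iff a x _ _).1 hs).tsum_eq, sub_self, mul_zero] at hd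
  obtain ⟨c, hc⟩ := hlip.absolutelyContinuousOnInterval.const_of_ae_hasDerivAt_zero hae
  rw [hc T Set.right_mem_uIcc, ← hc 0 Set.left_mem_uIcc, backSum_zero_left, hw.init]

theorem norm_le_of_isSolution (h : GeomBound a C) (hρ : 0 ≤ ρ) (hC : C * ρ ≤ 1 / 8) {r : ℂ}
    (hr : 2 * ‖r‖ < ρ) {w : ℝ → ℂ} (hw : IsSolution a r w) {x : ℝ}
    (hx : x ∈ Set.Icc (0 : ℝ) (2 * Real.pi)) : ‖w x‖ ≤ ρ := by
  by_contra! hlt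
  obtain ⟨K, hK⟩ := hw.lipschitz
  have hcont : ContinuousOn (fun y => ‖w y‖) (Set.Icc 0 (2 * Real.pi)) := hK.continuousOn.norm
  set S := Set.Icc (0 : ℝ) (2 * Real.pi) ∩ (fun y => ‖w y‖) ⁻¹' Set.Ici ρ with hS
  have hScl : IsClosed S := hcont.preimage_isClosed_of_isClosed isClosed_Icc isClosed_Ici
  have hSbd : BddBelow S := ⟨0, fun y hy => hy.1.1⟩
  have hSne : S.Nonempty := ⟨x, hx, hlt.le⟩
  have hmem := hScl.csInf_mem hSne hSbd
  set T := sInf S with hT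
  have hlow : ∀ y ∈ Set.Icc (0 : ℝ) (2 * Real.pi), y < T → ‖w y‖ < ρ := fun y hy hyT => by
    by_contra! hge
    exact absurd (csInf_le hSbd ⟨hy, hge⟩) (not_le.2 hyT)
  have hw0 : ‖w 0‖ < ρ := by
    rw [hw.init]
    linarith [norm_nonneg r]
  have hTpos : 0 < T := by
    refine lt_of_le_of_ne hmem.1.1 fun h0 => ?_
    have := hmem.2
    rw [← h0] at this
    exact absurd this (not_le.2 hw0)
  have hTle : ‖w T‖ ≤ ρ := by
    have hclos : T ∈ closure (Set.Ico 0 T) := by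
      rw [closure_Ico hTpos.ne]
      exact Set.right_mem_Icc.2 hTpos.le
    have hsub : Set.Ico 0 T ⊆ Set.Icc 0 (2 * Real.pi) :=
      fun y hy => ⟨hy.1, hy.2.le.trans hmem.1.2⟩
    have hmap := (hcont T hmem.1).mono hsub |>.mem_closure hclos
      (t := Set.Iic ρ) fun y hy => (hlow y (hsub hy) hy.2).le
    rwa [isClosed_Iic.closure_eq] at hmap
  have hb : ∀ y ∈ Set.Icc 0 T, ‖w y‖ ≤ ρ := fun y hy => by
    rcases hy.2.lt_or_eq with hlt | rfl
    · exact (hlow y ⟨hy.1, hy.2.trans hmem.1.2⟩ hlt).le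
    · exact hTle
  have h1 := h.norm_le_two_mul hρ hC hmem.1 hTle
  rw [h.backSum_eq_of_isSolution hρ hC hmem.1 hw hb] at h1
  exact absurd (hmem.2 : ρ ≤ ‖w T‖) (not_le.2 (h1.trans_lt hr))

theorem backSum_eq_of_isSolution_of_lt (h : GeomBound a C) (hρ : 0 ≤ ρ) (hC : C * ρ ≤ 1 / 8)
    {r : ℂ} (hr : 2 * ‖r‖ < ρ) {w : ℝ → ℂ} (hw : IsSolution a r w) {x : ℝ}
    (hx : x ∈ Set.Icc (0 : ℝ) (2 * Real.pi)) : backSum a x (w x) = r :=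
  h.backSum_eq_of_isSolution hρ hC hx hw fun _ hy =>
    h.norm_le_of_isSolution hρ hC hr hw ⟨hy.1, hy.2.trans hx.2⟩

theorem exists_backSum_eq (h : GeomBound a C) (hρ : 0 ≤ ρ) (hC : C * ρ ≤ 1 / 8) {x : ℝ}
    (hx : x ∈ Set.Icc (0 : ℝ) (2 * Real.pi)) {r : ℂ} (hr : 2 * ‖r‖ ≤ ρ) :
    ∃ z, ‖z‖ ≤ ρ ∧ backSum a x z = r := by
  set f : ℂ → ℂ := fun z => r - (backSum a x z - z) with hf
  have hE : ∀ z : ℂ, ‖z‖ ≤ ρ → ‖backSum a x z - z‖ ≤ 1 / 2 * ‖z‖ := fun z hz => by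
    simpa [backSum_zero_right] using
      h.norm_backSum_sub_sub_le hρ hC hx hz (w := 0) (by simpa using hρ)
  have hmaps : Set.MapsTo f (Metric.closedBall 0 ρ) (Metric.closedBall 0 ρ) := fun z hz => by
    rw [mem_closedBall_zero_iff] at hz ⊢
    refine (norm_sub_le _ _).trans ?_
    linarith [hE z hz]
  have hcontr : ContractingWith (1 / 2) (hmaps.restrict f _ _) := by
    refine ⟨by norm_num, LipschitzWith.of_dist_le_mul fun z w => ?_⟩
    have h1 := h.norm_backSum_sub_sub_le hρ hC hx
      (mem_closedBall_zero_iff.1 z.2) (mem_closedBall_zero_iff.1 w.2)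
    rw [Subtype.dist_eq, Subtype.dist_eq, dist_eq_norm, dist_eq_norm]
    simp only [Set.MapsTo.val_restrict_apply, hf, sub_sub_sub_cancel_left]
    rw [norm_sub_rev]
    simpa using h1
  obtain ⟨z, hz, hfix, -⟩ := hcontr.exists_fixedPoint' Metric.isClosed_closedBall.isComplete hmaps
    (Metric.mem_closedBall_self hρ) (edist_ne_top _ _)
  refine ⟨z, mem_closedBall_zero_iff.1 hz, ?_⟩
  have h2 : r - (backSum a x z - z) = z := hfix
  linear_combination -h2

theorem exists_isSolution (h : GeomBound a C) (hρ : 0 ≤ ρ) (hC : C * ρ ≤ 1 / 8) {r : ℂ}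
    (hr : 2 * ‖r‖ ≤ ρ) : ∃ v, IsSolution a r v := by
  have hex : ∀ x : ℝ, ∃ z, x ∈ Set.Icc (0 : ℝ) (2 * Real.pi) → ‖z‖ ≤ ρ ∧ backSum a x z = r := by
    intro x
    by_cases hx : x ∈ Set.Icc (0 : ℝ) (2 * Real.pi)
    · obtain ⟨z, hz⟩ := h.exists_backSum_eq hρ hC hx hr
      exact ⟨z, fun _ => hz⟩
    · exact ⟨0, fun hx' => absurd hx' hx⟩
  choose v hv using hex
  have hK : ∀ x ∈ Set.Icc (0 : ℝ) (2 * Real.pi), ∀ y ∈ Set.Icc (0 : ℝ) (2 * Real.pi),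
      ‖v y - v x‖ ≤ 4 * ρ * |y - x| := fun x hx y hy => by
    refine (h.norm_sub_le_two_mul hρ hC hy (hv y hy).1 (hv x hx).1).trans ?_
    have h1 := h.norm_backSum_sub_le hρ hC hx hy (hv x hx).1 (hv x hx).1
    rw [(hv x hx).2, sub_self, norm_zero, add_zero, abs_sub_comm] at h1
    rw [(hv y hy).2]
    linarith
  have hlip : LipschitzOnWith (4 * ρ.toNNReal) v (Set.Icc 0 (2 * Real.pi)) := by
    refine LipschitzOnWith.of_dist_le_mul fun x hx y hy => ?_
    rw [dist_eq_norm, Real.dist_eq]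
    push_cast
    rw [Real.coe_toNNReal _ hρ]
    exact hK y hy x hx
  refine ⟨v, ⟨_, hlip⟩, (ae_restrict_iff' measurableSet_Ioo).2 ?_, ?_⟩
  · filter_upwards [hlip.ae_differentiableWithinAt_of_mem_real, ae_hasDerivAt_backCoeff a] with
      x hdiff hq hx
    have hxI := Set.Ioo_subset_Icc_self hx
    have hd := ((hdiff hxI).differentiableAt (Icc_mem_nhds hx.1 hx.2)).hasDerivAt
    refine ⟨_, hd, (hasSum_coeff_iff a x _ _).2 ?_⟩
    have h1 := h.hasDerivAt_backSum hρ hC le_rfl hx (fun y hy => hK x hxI y hy)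
      (fun y hy => (hv y hy).1) hd hq
    have h2 : HasDerivAt (fun y => backSum a y (v y)) 0 x := by
      refine (hasDerivAt_const x r).congr_of_eventuallyEq ?_
      filter_upwards [Icc_mem_nhds hx.1 hx.2] with y hy using (hv y hy).2
    have h3 := (mul_eq_zero.1 (h1.unique h2)).resolve_left
      (h.backSumDeriv_ne_zero hρ hC hxI (hv x hxI).1)
    rw [sub_eq_zero.1 h3]
    exact (h.summable_norm_rhs hρ hC x (hv x hxI).1).of_norm.hasSum
  · have h0 := (hv 0 ⟨le_rfl, Real.two_pi_pos.le⟩).2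
    rwa [backSum_zero_left] at h0

end GeomBound

/-! ### The first return map -/

/-- The inverse of the first return map. -/
def backSeries (a : CoeffSeq) : ConvSeries where
  series := PowerSeries.mk fun n => n.casesOn 0 fun m => backCoeff a m (2 * Real.pi)
  coeff_zero := by simp
  coeff_one := by simp [backCoeff_zero]
  convergent := by
    obtain ⟨C, h⟩ := a.exists_geomBound
    have hC : C * (1 / (8 * C)) ≤ 1 / 8 := by
      have := h.pos
      field_simp
      rfl
    have hpos : 0 < 1 / (8 * C) := by have := h.pos; positivity
    refine ⟨1 / (8 * C), hpos, fun z hz => (summable_nat_add_iff 1).1 ?_⟩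
    simpa using h.summable hpos.le hC (Set.right_mem_Icc.2 Real.two_pi_pos.le) hz.le

theorem co_backSeries_succ (a : CoeffSeq) (m : ℕ) :
    (backSeries a).co (m + 1) = backCoeff a m (2 * Real.pi) := by
  simp [ConvSeries.co, backSeries]

/-- A radius on which all the estimates for the backward flow hold. -/
theorem exists_radius (a : CoeffSeq) :
    ∃ C ρ, GeomBound a C ∧ 0 < ρ ∧ C * ρ ≤ 1 / 8 := by
  obtain ⟨C, h⟩ := a.exists_geomBound
  have := h.pos
  exact ⟨C, 1 / (8 * C), h, by positivity, le_of_eq (by field_simp)⟩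

theorem GeomBound.eval_backSeries {a : CoeffSeq} {C ρ : ℝ} (h : GeomBound a C) (hρ : 0 ≤ ρ)
    (hC : C * ρ ≤ 1 / 8) {z : ℂ} (hz : ‖z‖ ≤ ρ) :
    (backSeries a).eval z = backSum a (2 * Real.pi) z := by
  have h1 := h.summable hρ hC (Set.right_mem_Icc.2 Real.two_pi_pos.le) hz
  have h2 : Summable fun n => PowerSeries.coeff n (backSeries a).series * z ^ n := by
    refine (summable_nat_add_iff 1).1 ?_
    simpa [backSeries] using h1
  rw [ConvSeries.eval, h2.tsum_eq_zero_add]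
  simp [backSum, backSeries]

/-- The first return map. -/
def returnMap (a : CoeffSeq) : ConvSeries := (backSeries a)⁻¹

theorem eventually_backSeries_returnMap (a : CoeffSeq) :
    ∀ᶠ r in 𝓝 (0 : ℂ), (backSeries a).eval ((returnMap a).eval r) = r := by
  have h1 : ConvSeries.comp (backSeries a) (returnMap a) = ConvSeries.identity :=
    inv_mul_cancel (backSeries a)
  filter_upwards [ConvSeries.eval_comp (backSeries a) (returnMap a), ConvSeries.eval_identity]
    with r hr hr'
  rw [← hr, h1, hr']

theorem isFirstReturnMap_returnMap (a : CoeffSeq) : IsFirstReturnMap a (returnMap a) := by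
  obtain ⟨C, ρ, h, hρ, hC⟩ := a.exists_radius
  have hsmall : ∀ᶠ r in 𝓝 (0 : ℂ), 2 * ‖r‖ < ρ := by
    have : Tendsto (fun r : ℂ => 2 * ‖r‖) (𝓝 0) (𝓝 (2 * ‖(0 : ℂ)‖)) :=
      (continuous_const.mul continuous_norm).tendsto 0
    rw [norm_zero, mul_zero] at this
    exact this.eventually_lt_const hρ
  have hend : 2 * Real.pi ∈ Set.Icc (0 : ℝ) (2 * Real.pi) :=
    Set.right_mem_Icc.2 Real.two_pi_pos.le
  filter_upwards [hsmall, (returnMap a).tendsto_eval.eventually hsmall,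
    a.eventually_backSeries_returnMap] with r hr hPr hinv
  obtain ⟨v, hv⟩ := h.exists_isSolution hρ.le hC hr.le
  have huniq : ∀ {x : ℝ}, x ∈ Set.Icc (0 : ℝ) (2 * Real.pi) → ∀ {z : ℂ}, ‖z‖ ≤ ρ →
      backSum a x z = r → z = v x := fun {x} hx {z} hz hzr => by
    have h1 := h.norm_sub_le_two_mul hρ.le hC hx hz (h.norm_le_of_isSolution hρ.le hC hr hv hx)
    rw [hzr, h.backSum_eq_of_isSolution_of_lt hρ.le hC hr hv hx, sub_self, norm_zero,
      mul_zero] at h1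
    exact sub_eq_zero.1 (norm_le_zero_iff.1 h1)
  refine ⟨v, hv, fun w hw x hx => huniq hx (h.norm_le_of_isSolution hρ.le hC hr hw hx)
    (h.backSum_eq_of_isSolution_of_lt hρ.le hC hr hw hx), ?_⟩
  have hP : ‖(returnMap a).eval r‖ ≤ ρ := by
    linarith [norm_nonneg ((returnMap a).eval r)]
  refine (huniq hend hP ?_).symm
  rw [← h.eval_backSeries hρ.le hC hP, hinv]

theorem isFirstReturnMap_iff (a : CoeffSeq) (f : ConvSeries) :
    IsFirstReturnMap a f ↔ f = returnMap a := by
  refine ⟨fun h => ConvSeries.ext_of_eventuallyEq ?_, fun h => h ▸ a.isFirstReturnMap_returnMap⟩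
  filter_upwards [h, a.isFirstReturnMap_returnMap] with r ⟨v, hv, _, hvr⟩ ⟨w, _, hw, hwr⟩
  rw [← hvr, ← hwr]
  exact hw v hv (Set.right_mem_Icc.2 Real.two_pi_pos.le)

theorem eventually_isSolution_eval (a : CoeffSeq) :
    ∀ᶠ r in 𝓝 (0 : ℂ), (∃ v, IsSolution a r v) ∧
      ∀ v, IsSolution a r v → v (2 * Real.pi) = (returnMap a).eval r := by
  filter_upwards [a.isFirstReturnMap_returnMap] with r ⟨v, hv, huniq, hvr⟩
  exact ⟨⟨v, hv⟩, fun w hw => hvr ▸ huniq w hw (Set.right_mem_Icc.2 Real.two_pi_pos.le)⟩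

end CoeffSeq

theorem IsSolution.comp_affine {a c : CoeffSeq} {r : ℂ} {v : ℝ → ℂ} {d : ℝ}
    (hv : IsSolution c r v) (hd0 : 0 ≤ d) (hd : d ≤ Real.pi)
    (hc : ∀ i, ∀ x ∈ Set.Ioo (0 : ℝ) (2 * Real.pi),
      c.coeff i (2⁻¹ * x + d) = 2 * a.coeff i x) :
    IsSolution a (v d) fun x => v (2⁻¹ * x + d) := by
  obtain ⟨K, hK⟩ := hv.lipschitz
  refine ⟨⟨K, ?_⟩, (ae_restrict_iff' measurableSet_Ioo).2 ?_, by simp⟩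
  · refine LipschitzOnWith.of_dist_le_mul fun x hx y hy => ?_
    refine (hK.dist_le_mul _ ⟨by linarith [hx.1], by linarith [hx.2]⟩ _
      ⟨by linarith [hy.1], by linarith [hy.2]⟩).trans ?_
    gcongr
    rw [Real.dist_eq, Real.dist_eq, add_sub_add_right_eq_sub, ← mul_sub, abs_mul]
    refine mul_le_of_le_one_left (abs_nonneg _) ?_
    norm_num
  · have hq : Measure.QuasiMeasurePreserving (fun x : ℝ => 2⁻¹ * x + d) volume volume := by
      refine (measurePreserving_add_right volume d).quasiMeasurePreserving.comp
        (g := fun x => x + d) (f := fun x : ℝ => 2⁻¹ * x) ⟨by fun_prop, ?_⟩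
      rw [Real.map_volume_mul_left (by norm_num)]
      exact Measure.smul_absolutelyContinuous
    filter_upwards [hq.ae ((ae_restrict_iff' measurableSet_Ioo).1 hv.ode)] with x hx hxI
    obtain ⟨v', hv', hs⟩ := hx ⟨by linarith [hxI.1], by linarith [hxI.2]⟩
    refine ⟨2⁻¹ * v', ?_, ?_⟩
    · have h1 : HasDerivAt (fun x : ℝ => 2⁻¹ * x + d) 2⁻¹ x := by
        simpa using ((hasDerivAt_id x).const_mul (2⁻¹ : ℝ)).add_const d
      refine (hv'.scomp x h1).congr_deriv ?_
      simp
    · refine (hs.mul_left 2⁻¹).congr_fun fun i => ?_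
      rw [hc i x hxI]
      ring

namespace CoeffSeq

theorem returnMap_mul (a b : CoeffSeq) :
    returnMap (a * b) = ConvSeries.comp (returnMap b) (returnMap a) := by
  apply ConvSeries.ext_of_eventuallyEq
  filter_upwards [(a * b).eventually_isSolution_eval, a.eventually_isSolution_eval,
    (returnMap a).tendsto_eval.eventually b.eventually_isSolution_eval,
    ConvSeries.eval_comp (returnMap b) (returnMap a)] with r ⟨⟨v, hv⟩, hab⟩ ⟨_, ha⟩ ⟨_, hb⟩ hcomp
  rw [hcomp, ← hab v hv]
  have h1 := hv.comp_affine (a := a) le_rfl Real.pi_pos.le fun i x hx => by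
    change concatFun (a.coeff i) (b.coeff i) _ = _
    rw [concatFun_of_le _ _ (by linarith [hx.1]) (by linarith [hx.2])]
    ring_nf
  rw [hv.init] at h1
  have h2 := hv.comp_affine (a := b) Real.pi_pos.le le_rfl fun i x hx => by
    change concatFun (a.coeff i) (b.coeff i) _ = _
    rw [concatFun_of_lt _ _ (by linarith [hx.1]) (by linarith [hx.2])]
    ring_nf
  have h3 := ha _ h1
  rw [inv_mul_cancel_left₀ two_ne_zero, add_zero] at h3
  rw [h3] at h2
  have h4 := hb _ h2
  rw [inv_mul_cancel_left₀ two_ne_zero, ← two_mul] at h4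
  exact h4

/-! ### Dependence on the iterated integrals -/

/-- Linear combinations of the basic iterated integrals with variable upper limit. -/
def iterSpan : Submodule ℂ (CoeffSeq → ℝ → ℂ) :=
  Submodule.span ℂ (Set.range fun w a x => iterIntTo a w x)

theorem continuous_of_mem_iterSpan {F : CoeffSeq → ℝ → ℂ} (hF : F ∈ iterSpan) (a : CoeffSeq) :
    Continuous (F a) := by
  induction hF using Submodule.span_induction with
  | mem F h =>
    obtain ⟨w, rfl⟩ := h
    exact continuous_iterIntTo a w
  | zero => exact continuous_const
  | add F G _ _ hF hG => exact hF.add hG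
  | smul c F _ hF => exact hF.const_smul c

theorem integral_mem_iterSpan (i : ℕ+) {F : CoeffSeq → ℝ → ℂ} (hF : F ∈ iterSpan) :
    (fun a x => ∫ s in (0 : ℝ)..x, a.coeff i s * F a s) ∈ iterSpan := by
  have hint : ∀ {F : CoeffSeq → ℝ → ℂ}, F ∈ iterSpan → ∀ a x,
      IntervalIntegrable (fun s => a.coeff i s * F a s) volume 0 x := fun hF a x =>
    (intervalIntegrable_coeff a i 0 x).mul_continuousOn
      (continuous_of_mem_iterSpan hF a).continuousOn
  induction hF using Submodule.span_induction with
  | mem F h =>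
    obtain ⟨w, rfl⟩ := h
    exact Submodule.subset_span ⟨i :: w, by simp only [iterIntTo]⟩
  | zero =>
    convert iterSpan.zero_mem using 1
    funext a x
    simp
  | add F G hF' hG' hF hG =>
    convert iterSpan.add_mem hF hG using 1
    funext a x
    simp only [Pi.add_apply, mul_add]
    exact intervalIntegral.integral_add (hint hF' a x) (hint hG' a x)
  | smul c F hF' hF =>
    convert iterSpan.smul_mem c hF using 1
    funext a x
    simp only [Pi.smul_apply, smul_eq_mul, mul_left_comm _ c]
    exact intervalIntegral.integral_const_mul _ _

theorem backCoeff_mem_iterSpan (m : ℕ) : (fun a => backCoeff a m) ∈ iterSpan := by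
  induction m using Nat.strong_induction_on with
  | _ m ih =>
    cases m with
    | zero =>
      refine Submodule.subset_span ⟨[], ?_⟩
      funext a x
      simp [iterIntTo, backCoeff_zero]
    | succ m =>
      have h1 : (fun a => backCoeff a (m + 1)) =
          -∑ p ∈ Finset.HasAntidiagonal.antidiagonal m, (p.1 + 1 : ℂ) • fun a x =>
            ∫ s in (0 : ℝ)..x, a.coeff p.2.succPNat s * backCoeff a p.1 s := by
        funext a x
        rw [backCoeff_succ]
        simp only [backDeriv, intervalIntegral.integral_neg, Pi.neg_apply, Finset.sum_apply,
          Pi.smul_apply, smul_eq_mul]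
        rw [intervalIntegral.integral_finsetSum]
        · congr 1
          refine Finset.sum_congr rfl fun p _ => ?_
          rw [← intervalIntegral.integral_const_mul]
          congr 1
          funext s
          rw [nth]
          ring
        · exact fun p _ => (intervalIntegrable_nth a p.2 _ _).continuousOn_mul
            (continuous_const.mul (continuous_backCoeff a p.1)).continuousOn
      rw [h1]
      refine iterSpan.neg_mem (iterSpan.sum_mem fun p hp => iterSpan.smul_mem _
        (integral_mem_iterSpan _ (ih p.1 ?_)))
      have := Finset.HasAntidiagonal.mem_antidiagonal.1 hp
      omega

theorem exists_continuous_of_mem_iterSpan {F : CoeffSeq → ℝ → ℂ} (hF : F ∈ iterSpan) :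
    ∃ G : GX → ℂ, Continuous G ∧ ∀ a, G (GX.mk a) = F a (2 * Real.pi) := by
  induction hF using Submodule.span_induction with
  | mem F h =>
    obtain ⟨w, rfl⟩ := h
    exact ⟨GX.iterInt w, GX.continuous_iterInt w, fun a => rfl⟩
  | zero => exact ⟨fun _ => 0, continuous_const, fun a => rfl⟩
  | add F G _ _ hF hG =>
    obtain ⟨F', hF1, hF2⟩ := hF
    obtain ⟨G', hG1, hG2⟩ := hG
    exact ⟨fun g => F' g + G' g, hF1.add hG1, fun a => by simp [hF2, hG2]⟩
  | smul c F _ hF =>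
    obtain ⟨F', hF1, hF2⟩ := hF
    exact ⟨fun g => c * F' g, continuous_const.mul hF1, fun a => by simp [hF2]⟩

end CoeffSeq

namespace GX

open CoeffSeq

theorem exists_continuous_co_backSeries (n : ℕ) :
    ∃ G : GX → ℂ, Continuous G ∧ ∀ a, G (mk a) = (backSeries a).co n := by
  cases n with
  | zero => exact ⟨fun _ => 0, continuous_const, fun a => (ConvSeries.co_zero _).symm⟩
  | succ m =>
    simp only [co_backSeries_succ]
    exact exists_continuous_of_mem_iterSpan (backCoeff_mem_iterSpan m)

theorem backSeries_eq_of_equiv (a b : CoeffSeq) (h : a ≈ b) : backSeries a = backSeries b := by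
  refine ConvSeries.ext_co fun n => ?_
  obtain ⟨G, -, hG⟩ := exists_continuous_co_backSeries n
  rw [← hG a, ← hG b, mk, mk, Quotient.sound h]

/-- The first return map as a homomorphism on `G(X)`. -/
def returnHom : GX →* ConvSeries :=
  MonoidHom.mk' (Quotient.lift returnMap fun a b h => by
    rw [returnMap, returnMap, backSeries_eq_of_equiv a b h]) (by
      rintro ⟨a⟩ ⟨b⟩
      exact returnMap_mul a b)

theorem returnHom_mk (a : CoeffSeq) : returnHom (mk a) = returnMap a := rfl

theorem continuous_returnHom : Continuous returnHom := by
  have h : Continuous fun g => (returnHom g)⁻¹ := ConvSeries.continuous_of_co fun n _ => by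
    obtain ⟨G, hc, hG⟩ := exists_continuous_co_backSeries n
    convert hc using 1
    funext g
    obtain ⟨a⟩ := g
    refine Eq.trans ?_ (hG a).symm
    change ((returnMap a)⁻¹).co n = _
    rw [returnMap, inv_inv]
  exact (continuous_inv.comp h).congr fun g => inv_inv _

theorem ker_returnHom : (returnHom.ker : Set GX) = mk '' centerSet := by
  have key : ∀ a, returnMap a = 1 ↔ a ∈ centerSet := fun a => by
    constructor
    · intro h
      filter_upwards [a.eventually_isSolution_eval, ConvSeries.eval_identity] with
        r ⟨⟨v, hv⟩, hval⟩ hid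
      refine ⟨v, hv, ?_⟩
      rw [hval v hv, h, hv.init]
      exact hid.symm
    · intro h
      apply ConvSeries.ext_of_eventuallyEq
      filter_upwards [h, a.eventually_isSolution_eval, ConvSeries.eval_identity] with
        r ⟨v, hv, hcl⟩ ⟨_, hval⟩ hid
      rw [← hval v hv, ← hcl, hv.init]
      exact hid.symm
  ext g
  constructor
  · obtain ⟨a⟩ := g
    exact fun h => ⟨a, (key a).1 h, rfl⟩
  · rintro ⟨a, ha, rfl⟩
    exact (key a).2 ha

theorem isClosed_ker_returnHom : IsClosed (returnHom.ker : Set GX) := by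
  have : (returnHom.ker : Set GX) =
      ⋂ n, {g | (returnHom g).co n = (1 : ConvSeries).co n} := by
    ext g
    simp only [SetLike.mem_coe, MonoidHom.mem_ker, Set.mem_iInter, Set.mem_ofPred_eq]
    exact ⟨fun h n => by rw [h], ConvSeries.ext_co⟩
  rw [this]
  exact isClosed_iInter fun n =>
    isClosed_eq ((ConvSeries.continuous_co n).comp continuous_returnHom) continuous_const

end GX

/-! ### Surjectivity of the first return map -/

namespace ConvSeries

theorem exists_norm_co_succ_le (g : ConvSeries) :
    ∃ M : ℝ, 0 < M ∧ ∀ m, ‖co (m + 1) g‖ ≤ M ^ m := by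
  obtain ⟨ρ, hρ, h⟩ := g.convergent
  have h1 := (h ((ρ / 2 : ℝ) : ℂ) (by
    rw [Complex.norm_real, Real.norm_of_nonneg (by positivity)]; linarith)).tendsto_atTop_zero
  obtain ⟨K, hK⟩ := h1.norm.bddAbove_range
  have hb : ∀ n, ‖co n g‖ * (ρ / 2) ^ n ≤ K := fun n => by
    have := hK ⟨n, rfl⟩
    simp only [norm_mul, norm_pow, Complex.norm_real,
      Real.norm_of_nonneg (show 0 ≤ ρ / 2 by positivity)] at this
    exact this
  have hK0 : 0 ≤ K := le_trans (by positivity) (hb 0)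
  refine ⟨(K / (ρ / 2) + 1) / (ρ / 2), by positivity, fun m => ?_⟩
  rcases Nat.eq_zero_or_pos m with rfl | hm
  · simp [co_one]
  · rw [div_pow, le_div_iff₀ (by positivity)]
    have h2 : K / (ρ / 2) + 1 ≤ (K / (ρ / 2) + 1) ^ m :=
      le_self_pow₀ (by linarith [show 0 ≤ K / (ρ / 2) by positivity]) hm.ne'
    have h3 : ‖co (m + 1) g‖ * (ρ / 2) ^ m ≤ K / (ρ / 2) := by
      rw [le_div_iff₀ (by positivity), mul_assoc, ← pow_succ]
      exact hb _
    linarith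

end ConvSeries

namespace CoeffSeq

/-- The coefficients of the equation whose backward flow at time `2 π t` is
`z + t ∑ G m z ^ (m + 1)`, the sum being over `m ≥ 1`. -/
def isotopyCoeff (G : ℕ → ℂ) : ℕ → ℝ → ℂ
  | m, t => -G (m + 1) / (2 * Real.pi : ℝ) -
      t * ∑ i : Fin m, ((m - i : ℕ) + 1 : ℂ) * G (m - i) * isotopyCoeff G i t
  decreasing_by exact i.2

theorem isotopyCoeff_eq (G : ℕ → ℂ) (m : ℕ) (t : ℝ) :
    isotopyCoeff G m t = -G (m + 1) / (2 * Real.pi : ℝ) -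
      t * ∑ i ∈ Finset.range m, ((m - i : ℕ) + 1 : ℂ) * G (m - i) * isotopyCoeff G i t := by
  rw [isotopyCoeff, Finset.sum_range
    (fun i => ((m - i : ℕ) + 1 : ℂ) * G (m - i) * isotopyCoeff G i t)]

theorem continuous_isotopyCoeff (G : ℕ → ℂ) (m : ℕ) : Continuous (isotopyCoeff G m) := by
  induction m using Nat.strong_induction_on with
  | _ m ih =>
    rw [funext (isotopyCoeff_eq G m)]
    exact continuous_const.sub (Complex.continuous_ofReal.mul
      (continuous_finsetSum _ fun i hi => continuous_const.mul (ih i (Finset.mem_range.1 hi))))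

theorem norm_isotopyCoeff_le {G : ℕ → ℂ} {M : ℝ} (hM : 0 < M) (hG : ∀ m, ‖G m‖ ≤ M ^ m) (m : ℕ)
    {t : ℝ} (ht : t ∈ Set.Icc (0 : ℝ) 1) : ‖isotopyCoeff G m t‖ ≤ (8 * M) ^ (m + 1) := by
  induction m using Nat.strong_induction_on with
  | _ m ih =>
    have hπ : 1 ≤ 2 * Real.pi := by linarith [Real.pi_gt_three]
    have h1 : ‖-G (m + 1) / (2 * Real.pi : ℝ)‖ ≤ 1 / 8 * (8 * M) ^ (m + 1) := by
      rw [norm_div, norm_neg, Complex.norm_real, Real.norm_of_nonneg (by linarith)]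
      refine (div_le_self (norm_nonneg _) hπ).trans ((hG _).trans ?_)
      rw [mul_pow, ← mul_assoc]
      refine le_mul_of_one_le_left (by positivity) ?_
      rw [pow_succ]
      linarith [one_le_pow₀ (M₀ := ℝ) (show (1 : ℝ) ≤ 8 by norm_num) (n := m)]
    have h2 : ∀ i ∈ Finset.range m, ‖((m - i : ℕ) + 1 : ℂ) * G (m - i) * isotopyCoeff G i t‖ ≤
        (8 * M) ^ (m + 1) * (1 / 4 * (1 / 4) ^ (m - 1 - i)) := by
      intro i hi
      have him := Finset.mem_range.1 hi
      obtain ⟨k, rfl⟩ : ∃ k, m = i + (k + 1) := ⟨m - i - 1, by omega⟩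
      rw [show i + (k + 1) - i = k + 1 by omega, show i + (k + 1) - 1 - i = k by omega]
      have h3 : ‖((k + 1 : ℕ) + 1 : ℂ)‖ = ((k + 1 + 1 : ℕ) : ℝ) := by
        rw [← Complex.norm_natCast]; push_cast; rfl
      have h4 : ((k + 1 + 1 : ℕ) : ℝ) ≤ 2 ^ (k + 1) := by
        exact_mod_cast Nat.lt_two_pow_self (n := k + 1)
      rw [norm_mul, norm_mul, h3]
      calc ((k + 1 + 1 : ℕ) : ℝ) * ‖G (k + 1)‖ * ‖isotopyCoeff G i t‖
          ≤ (2 ^ (k + 1) * M ^ (k + 1)) * (8 * M) ^ (i + 1) := by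
            gcongr
            · exact hG _
            · exact ih i him
        _ = (8 * M) ^ (i + (k + 1) + 1) * (1 / 4 * (1 / 4) ^ k) := by
            rw [← pow_succ', show (8 * M) ^ (i + (k + 1) + 1) = (8 * M) ^ (i + 1) *
              (8 * M) ^ (k + 1) by ring, mul_assoc _ _ ((1 / 4 : ℝ) ^ (k + 1)), ← mul_pow,
              ← mul_pow, show 8 * M * (1 / 4) = 2 * M by ring]
            ring
    have h5 : ‖∑ i ∈ Finset.range m, ((m - i : ℕ) + 1 : ℂ) * G (m - i) * isotopyCoeff G i t‖ ≤
        (8 * M) ^ (m + 1) * (1 / 3) := by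
      refine (norm_sum_le_of_le _ h2).trans ?_
      rw [← Finset.mul_sum, Finset.sum_range_reflect (fun j => (1 / 4 * (1 / 4) ^ j : ℝ)) m,
        ← Finset.mul_sum]
      gcongr
      have h6 := (summable_geometric_of_lt_one (r := (1 / 4 : ℝ)) (by norm_num)
        (by norm_num)).sum_le_tsum (Finset.range m) fun _ _ => by positivity
      rw [tsum_geometric_of_lt_one (by norm_num) (by norm_num)] at h6
      norm_num at h6 ⊢
      linarith
    rw [isotopyCoeff_eq]
    refine (norm_sub_le _ _).trans ?_
    rw [norm_mul, Complex.norm_real, Real.norm_of_nonneg ht.1]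
    have h7 := (mul_le_of_le_one_left (norm_nonneg _) ht.2).trans h5
    have h8 : 0 < (8 * M) ^ (m + 1) := by positivity
    linarith

/-- The equation whose backward flow is the linear isotopy from the identity to a given series. -/
def isotopy (g : ConvSeries) : CoeffSeq where
  coeff i x := isotopyCoeff (fun m => g.co (m + 1)) i.natPred
    (toIocMod Real.two_pi_pos 0 x / (2 * Real.pi))
  measurable_coeff i := (continuous_isotopyCoeff _ _).measurable.comp
    (measurable_toIocMod.div_const _)
  periodic_coeff i x := by simp
  bound_coeff := by
    obtain ⟨M, hM, hG⟩ := g.exists_norm_co_succ_le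
    refine ⟨8 * M, by positivity, fun i x => ?_⟩
    have hmem := toIocMod_mem_Ioc Real.two_pi_pos 0 x
    rw [zero_add] at hmem
    have h := norm_isotopyCoeff_le hM hG i.natPred
      (t := toIocMod Real.two_pi_pos 0 x / (2 * Real.pi))
      ⟨div_nonneg hmem.1.le Real.two_pi_pos.le, (div_le_one Real.two_pi_pos).2 hmem.2⟩
    rwa [PNat.natPred_add_one] at h

theorem nth_isotopy (g : ConvSeries) (k : ℕ) (x : ℝ) :
    (isotopy g).nth k x = isotopyCoeff (fun m => g.co (m + 1)) k
      (toIocMod Real.two_pi_pos 0 x / (2 * Real.pi)) := by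
  simp [nth, isotopy]

theorem backCoeff_isotopy (g : ConvSeries) (m : ℕ) {x : ℝ}
    (hx : x ∈ Set.Icc (0 : ℝ) (2 * Real.pi)) :
    backCoeff (isotopy g) (m + 1) x = (x / (2 * Real.pi) : ℝ) * g.co (m + 2) := by
  induction m using Nat.strong_induction_on generalizing x with
  | _ m ih =>
    have hd : ∀ s ∈ Set.Ioc 0 x,
        backDeriv (isotopy g) m s = g.co (m + 2) / (2 * Real.pi : ℝ) := by
      intro s hs
      have hsI : s ∈ Set.Icc (0 : ℝ) (2 * Real.pi) := ⟨hs.1.le, hs.2.trans hx.2⟩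
      have hmod : toIocMod Real.two_pi_pos 0 s = s :=
        (toIocMod_eq_self _).2 ⟨hs.1, by linarith [hsI.2]⟩
      rw [backDeriv, ← Finset.Nat.sum_antidiagonal_swap,
        Finset.Nat.sum_antidiagonal_eq_sum_range_succ_mk, Finset.sum_range_succ]
      simp only [Prod.swap_prod_mk, nth_isotopy, hmod]
      rw [Nat.sub_self, backCoeff_zero, isotopyCoeff_eq _ m]
      have hsum : ∑ i ∈ Finset.range m, ((m - i : ℕ) + 1 : ℂ) * backCoeff (isotopy g) (m - i) s *
          isotopyCoeff (fun m => g.co (m + 1)) i (s / (2 * Real.pi)) =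
          (s / (2 * Real.pi) : ℝ) * ∑ i ∈ Finset.range m, ((m - i : ℕ) + 1 : ℂ) *
            g.co (m - i + 1) * isotopyCoeff (fun m => g.co (m + 1)) i (s / (2 * Real.pi)) := by
        rw [Finset.mul_sum]
        refine Finset.sum_congr rfl fun i hi => ?_
        obtain ⟨k, hk⟩ : ∃ k, m = i + (k + 1) :=
          ⟨m - i - 1, by have := Finset.mem_range.1 hi; omega⟩
        rw [show m - i = k + 1 by omega, ih k (by omega) hsI]
        ring
      rw [hsum]
      push_cast
      ring
    rw [backCoeff_succ, intervalIntegral.integral_congr_ae (g := fun _ =>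
      g.co (m + 2) / (2 * Real.pi : ℝ)) (Eventually.of_forall fun s hs => hd s ?_)]
    · rw [intervalIntegral.integral_const]
      simp only [sub_zero, Complex.real_smul, Complex.ofReal_div]
      ring
    · rwa [Set.uIoc_of_le hx.1] at hs

theorem backSeries_isotopy (g : ConvSeries) : backSeries (isotopy g) = g := by
  refine ConvSeries.ext_co fun n => ?_
  match n with
  | 0 => rw [ConvSeries.co_zero, ConvSeries.co_zero]
  | 1 => rw [ConvSeries.co_one, ConvSeries.co_one]
  | m + 2 =>
    rw [co_backSeries_succ, backCoeff_isotopy g m (Set.right_mem_Icc.2 Real.two_pi_pos.le),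
      div_self Real.two_pi_pos.ne', Complex.ofReal_one, one_mul]

/-! ### A center that is not universal -/

/-- The sequence `(cos, sin, 0, 0, …)`. -/
def cosSin : CoeffSeq where
  coeff i x := if i = 1 then (Real.cos x : ℂ) else if i = 2 then (Real.sin x : ℂ) else 0
  measurable_coeff i := by
    split_ifs
    · exact (Complex.continuous_ofReal.comp Real.continuous_cos).measurable
    · exact (Complex.continuous_ofReal.comp Real.continuous_sin).measurable
    · exact measurable_const
  periodic_coeff i x := by simp only [Real.cos_add_two_pi, Real.sin_add_two_pi]
  bound_coeff := by
    refine ⟨1, one_pos, fun i x => ?_⟩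
    rw [one_pow]
    split_ifs
    · rw [Complex.norm_real]
      exact Real.abs_cos_le_one x
    · rw [Complex.norm_real]
      exact Real.abs_sin_le_one x
    · simp

theorem coeff_one_cosSin (x : ℝ) : cosSin.coeff 1 x = (Real.cos x : ℂ) := rfl

theorem coeff_two_cosSin (x : ℝ) : cosSin.coeff 2 x = (Real.sin x : ℂ) := rfl

theorem backCoeff_one_cosSin (x : ℝ) : backCoeff cosSin 1 x = ((-Real.sin x : ℝ) : ℂ) := by
  have h : ∀ s, backDeriv cosSin 0 s = ((-Real.cos s : ℝ) : ℂ) := fun s => by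
    simp only [backDeriv, Finset.HasAntidiagonal.antidiagonal_zero, Finset.sum_singleton,
      backCoeff_zero]
    rw [show cosSin.nth 0 s = (Real.cos s : ℂ) from rfl]
    push_cast
    ring
  rw [backCoeff_succ]
  simp only [h]
  rw [intervalIntegral.integral_ofReal, intervalIntegral.integral_neg, integral_cos,
    Real.sin_zero, sub_zero]

theorem backCoeff_two_cosSin : backCoeff cosSin 2 (2 * Real.pi) = 0 := by
  have h : ∀ s, backDeriv cosSin 1 s = ((2 * Real.sin s * Real.cos s - Real.sin s : ℝ) : ℂ) :=
    fun s => by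
    rw [backDeriv, Finset.Nat.sum_antidiagonal_eq_sum_range_succ_mk]
    simp only [Finset.sum_range_succ, Finset.sum_range_zero, Nat.sub_zero, Nat.sub_self,
      backCoeff_zero, backCoeff_one_cosSin]
    rw [show cosSin.nth 0 s = (Real.cos s : ℂ) from rfl,
      show cosSin.nth 1 s = (Real.sin s : ℂ) from rfl]
    push_cast
    ring
  rw [backCoeff_succ]
  simp only [h]
  rw [intervalIntegral.integral_ofReal, intervalIntegral.integral_eq_sub_of_hasDerivAt
    (f := fun s => Real.sin s ^ 2 + Real.cos s)]
  · simp
  · intro s _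
    refine (((Real.hasDerivAt_sin s).pow 2).add (Real.hasDerivAt_cos s)).congr_deriv ?_
    simp
    ring
  · exact Continuous.intervalIntegrable (by fun_prop) _ _

theorem iterInt_cosSin : iterInt [2, 1] cosSin = Real.pi := by
  have h : ∀ s, iterIntTo cosSin [1] s = ((Real.sin s : ℝ) : ℂ) := fun s => by
    simp only [iterIntTo, mul_one, coeff_one_cosSin]
    rw [intervalIntegral.integral_ofReal, integral_cos, Real.sin_zero, sub_zero]
  rw [iterInt, iterIntTo]
  simp only [h, coeff_two_cosSin, ← sq, ← Complex.ofReal_pow]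
  rw [intervalIntegral.integral_ofReal, integral_sin_sq]
  simp

theorem isotopy_coeff_two_eq_zero {g : ConvSeries} (h2 : g.co 2 = 0) (h3 : g.co 3 = 0) (x : ℝ) :
    (isotopy g).coeff 2 x = 0 := by
  change (isotopy g).nth 1 x = 0
  rw [nth_isotopy, isotopyCoeff_eq, Finset.sum_range_one, h3, h2]
  simp

end CoeffSeq

namespace GX

open CoeffSeq

theorem returnHom_surjective : Function.Surjective returnHom := fun f =>
  ⟨mk (isotopy f⁻¹), by rw [returnHom_mk, returnMap, backSeries_isotopy, inv_inv]⟩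

theorem ker_returnHom_ne_bot : returnHom.ker ≠ ⊥ := by
  intro h
  set a := isotopy (backSeries cosSin) with ha
  have h1 : returnHom (mk a) = returnHom (mk cosSin) := by
    rw [returnHom_mk, returnHom_mk, returnMap, returnMap, backSeries_isotopy]
  have h2 := (MonoidHom.ker_eq_bot_iff returnHom).1 h h1
  have h3 := congrFun ((mk_eq_mk_iff a cosSin).1 h2) [2, 1]
  rw [iterInt_cosSin] at h3
  have h4 : CoeffSeq.iterInt [2, 1] a = 0 := by
    rw [CoeffSeq.iterInt, iterIntTo]
    simp only [ha, isotopy_coeff_two_eq_zero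
      (by rw [co_backSeries_succ, backCoeff_one_cosSin]; simp)
      (by rw [co_backSeries_succ, backCoeff_two_cosSin]), zero_mul,
      intervalIntegral.integral_zero]
  rw [h4] at h3
  exact Real.pi_ne_zero (Complex.ofReal_eq_zero.1 h3.symm)

end GX

/-! ### Scaling -/

namespace CoeffSeq

/-- The sequence `(t a₁, t² a₂, …)`. -/
def scale (t : ℝ) (a : CoeffSeq) : CoeffSeq where
  coeff i x := (t : ℂ) ^ (i : ℕ) * a.coeff i x
  measurable_coeff i := (a.measurable_coeff i).const_mul _
  periodic_coeff i x := by
    simp only [a.periodic_coeff i x]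
  bound_coeff := by
    obtain ⟨l, hl, h⟩ := a.bound_coeff
    refine ⟨(|t| + 1) * l, by positivity, fun i x => ?_⟩
    rw [norm_mul, norm_pow, Complex.norm_real, mul_pow, Real.norm_eq_abs]
    gcongr
    · linarith
    · exact h i x

/-- The weight of a word. -/
def weight (w : List ℕ+) : ℕ := (w.map fun i : ℕ+ => (i : ℕ)).sum

theorem iterIntTo_scale (t : ℝ) (a : CoeffSeq) (w : List ℕ+) (x : ℝ) :
    iterIntTo (scale t a) w x = (t : ℂ) ^ weight w * iterIntTo a w x := by
  induction w generalizing x with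
  | nil => simp [iterIntTo, weight]
  | cons i w ih =>
    simp only [iterIntTo, ih]
    rw [← intervalIntegral.integral_const_mul]
    congr 1
    funext s
    simp only [scale, weight, List.map_cons, List.sum_cons, pow_add]
    ring

theorem backCoeff_scale (t : ℝ) (a : CoeffSeq) (m : ℕ) (x : ℝ) :
    backCoeff (scale t a) m x = (t : ℂ) ^ m * backCoeff a m x := by
  induction m using Nat.strong_induction_on generalizing x with
  | _ m ih =>
    cases m with
    | zero => simp [backCoeff_zero]
    | succ m =>
      rw [backCoeff_succ, backCoeff_succ, ← intervalIntegral.integral_const_mul]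
      congr 1
      funext s
      rw [backDeriv, backDeriv, mul_neg, Finset.mul_sum]
      congr 1
      refine Finset.sum_congr rfl fun p hp => ?_
      have hp' := Finset.HasAntidiagonal.mem_antidiagonal.1 hp
      rw [ih p.1 (by omega),
        show (scale t a).nth p.2 s = (t : ℂ) ^ (p.2 + 1) * a.nth p.2 s from rfl, ← hp']
      ring

end CoeffSeq

namespace GX

open CoeffSeq

/-- The action of scaling on classes. -/
def scale (t : ℝ) : GX → GX :=
  Quotient.map (CoeffSeq.scale t) fun a b h => by
    rw [equiv_iff] at h ⊢
    funext w
    rw [CoeffSeq.iterInt, CoeffSeq.iterInt, iterIntTo_scale, iterIntTo_scale]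
    exact congrArg _ (congrFun h w)

theorem iterInt_scale (t : ℝ) (g : GX) (w : List ℕ+) :
    iterInt w (scale t g) = (t : ℂ) ^ weight w * iterInt w g := by
  obtain ⟨a⟩ := g
  exact iterIntTo_scale t a w _

theorem scale_one (g : GX) : scale 1 g = g :=
  ext_iterInt fun w => by simp [iterInt_scale]

theorem iterInt_one_cons (i : ℕ+) (w : List ℕ+) : iterInt (i :: w) 1 = 0 :=
  congrFun iterInt_one (i :: w)

theorem scale_zero (g : GX) : scale 0 g = 1 :=
  ext_iterInt fun w => by
    rw [iterInt_scale]
    cases w with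
    | nil => simp [weight, iterInt_nil]
    | cons i w =>
      rw [iterInt_one_cons, weight, List.map_cons, List.sum_cons, pow_add]
      simp

theorem iterInt_scale_sub (t : ℝ) (g : GX) (w : List ℕ+) :
    iterInt w (scale t g) - iterInt w 1 = (t : ℂ) ^ weight w * (iterInt w g - iterInt w 1) := by
  rw [iterInt_scale]
  cases w with
  | nil => simp [iterInt_nil, weight]
  | cons i w => simp [iterInt_one_cons]

theorem continuous_scale : Continuous fun p : ℝ × GX => scale p.1 p.2 :=
  continuous_iff.2 fun w => by
    simp only [iterInt_scale]
    exact ((Complex.continuous_ofReal.comp continuous_fst).pow _).mul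
      ((continuous_iterInt w).comp continuous_snd)

theorem scale_mem_ker {t : ℝ} {g : GX} (hg : g ∈ returnHom.ker) : scale t g ∈ returnHom.ker := by
  obtain ⟨a⟩ := g
  have h1 : backSeries a = 1 := inv_eq_one.1 hg
  refine inv_eq_one.2 (ConvSeries.ext_co fun n => ?_)
  match n with
  | 0 => rw [ConvSeries.co_zero, ConvSeries.co_zero]
  | 1 => rw [ConvSeries.co_one, ConvSeries.co_one]
  | m + 2 =>
    rw [co_backSeries_succ, backCoeff_scale, ← co_backSeries_succ, h1,
      ConvSeries.co_one_series (by omega), mul_zero]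

/-! ### Topology of the kernel -/

theorem isInducing_iterInt : IsInducing fun (g : GX) (w : List ℕ+) => iterInt w g := by
  constructor
  rw [Pi.topologicalSpace, induced_iInf]
  simp only [induced_compose]
  rfl

/-- Scaling on the kernel of the first return homomorphism. -/
def scaleKer (t : unitInterval) (g : returnHom.ker) : returnHom.ker :=
  ⟨scale t g, scale_mem_ker g.2⟩

theorem continuous_scaleKer : Continuous fun p : unitInterval × returnHom.ker => scaleKer p.1 p.2 :=
  Continuous.subtype_mk (continuous_scale.comp ((continuous_subtype_val.comp continuous_fst).prodMk
    (continuous_subtype_val.comp continuous_snd))) _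

/-- Subsets of the kernel that contain `1` and are stable under scaling are contractible. -/
theorem contractibleSpace_of_scaleKer_mem {V : Set returnHom.ker} (h1 : 1 ∈ V)
    (hV : ∀ t, ∀ g ∈ V, scaleKer t g ∈ V) : ContractibleSpace V := by
  rw [contractible_iff_id_nullhomotopic]
  refine ⟨⟨1, h1⟩, ⟨?_⟩⟩
  refine
    { toFun := fun p => ⟨scaleKer (unitInterval.symm p.1) p.2, hV _ _ p.2.2⟩
      continuous_toFun := Continuous.subtype_mk (continuous_scaleKer.comp
        ((unitInterval.continuous_symm.comp continuous_fst).prodMk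
          (continuous_subtype_val.comp continuous_snd))) _
      map_zero_left := fun g => ?_
      map_one_left := fun g => ?_ }
  · refine Subtype.ext (Subtype.ext ?_)
    simp [scaleKer, scale_one]
  · refine Subtype.ext (Subtype.ext ?_)
    simp [scaleKer, scale_zero]

instance contractibleSpace_ker : ContractibleSpace returnHom.ker := by
  have := contractibleSpace_of_scaleKer_mem (V := Set.univ) trivial fun _ _ _ => trivial
  exact (Homeomorph.Set.univ returnHom.ker).symm.contractibleSpace

/-- The unit of the kernel has a basis of open neighbourhoods stable under scaling. -/
theorem exists_isOpen_scaleKer_mem {U : Set returnHom.ker} (hU : U ∈ 𝓝 1) :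
    ∃ V : Set returnHom.ker, IsOpen V ∧ 1 ∈ V ∧ V ⊆ U ∧ ∀ t, ∀ g ∈ V, scaleKer t g ∈ V := by
  have hind := isInducing_iterInt.comp (IsInducing.subtypeVal (t := (returnHom.ker : Set GX)))
  rw [hind.nhds_eq_comap, mem_comap] at hU
  obtain ⟨W, hW, hWU⟩ := hU
  rw [nhds_pi, mem_pi'] at hW
  obtain ⟨I, s, hs, hIs⟩ := hW
  choose ε hε hball using fun w => Metric.mem_nhds_iff.1 (hs w)
  refine ⟨⋂ w ∈ I, {g | dist (iterInt w g) (iterInt w 1) < ε w},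
    isOpen_biInter_finset fun w _ => isOpen_lt
      (((continuous_iterInt w).comp continuous_subtype_val).dist continuous_const)
      continuous_const, ?_, fun g hg => hWU (hIs fun w hw => hball w ?_), fun t g hg => ?_⟩
  · simp [hε]
  · exact Set.mem_iInter₂.1 hg w hw
  · refine Set.mem_iInter₂.2 fun w hw => ?_
    have hgw : dist (iterInt w g) (iterInt w 1) < ε w := Set.mem_iInter₂.1 hg w hw
    change dist (iterInt w (scale t g)) (iterInt w 1) < ε w
    refine lt_of_le_of_lt ?_ hgw
    rw [dist_eq_norm, dist_eq_norm]
    rw [iterInt_scale_sub, norm_mul, norm_pow, Complex.norm_real, Real.norm_of_nonneg t.2.1]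
    exact mul_le_of_le_one_left (norm_nonneg _) (pow_le_one₀ t.2.1 t.2.2)

theorem locallySimplyConnected_ker : LocallySimplyConnected returnHom.ker := by
  intro y U hU
  have h1 : (y * ·) ⁻¹' U ∈ 𝓝 (1 : returnHom.ker) :=
    (continuous_const_mul y).continuousAt (by rwa [mul_one])
  obtain ⟨V, hVo, hV1, hVU, hVs⟩ := exists_isOpen_scaleKer_mem h1
  refine ⟨Homeomorph.mulLeft y '' V, (Homeomorph.mulLeft y).isOpenMap V hVo,
    ⟨1, hV1, mul_one y⟩, Set.image_subset_iff.2 hVU, ?_⟩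
  have := contractibleSpace_of_scaleKer_mem hV1 hVs
  exact (Homeomorph.mulLeft y).isEmbedding.isSimplyConnected_image.2
    (SimplyConnectedSpace.ofContractible V)

end GX

theorem LocallySimplyConnected.locallyPathConnectedSpace {Y : Type*} [TopologicalSpace Y]
    (h : LocallySimplyConnected Y) : LocallyPathConnectedSpace Y where
  path_connected_basis y := ⟨fun U => ⟨fun hU => by
    obtain ⟨V, hVo, hyV, hVU, hV⟩ := h y U hU
    exact ⟨V, ⟨hVo.mem_nhds hyV, hV.isPathConnected⟩, hVU⟩,
    fun ⟨_, ⟨hV, _⟩, hVU⟩ => mem_of_superset hV hVU⟩⟩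

end

end CenterProblem

open CenterProblem in
theorem theorem3p7 :
    IsTopologicalGroup GX ∧ IsTopologicalGroup ConvSeries ∧
    ∃ P : CoeffSeq → ConvSeries,
      (∀ (a : CoeffSeq) (f : ConvSeries), IsFirstReturnMap a f ↔ f = P a) ∧
      (∀ a b : CoeffSeq, P (a * b) = ConvSeries.comp (P b) (P a)) ∧
      ∃ Phat : GX →* ConvSeries,
        (∀ a : CoeffSeq, Phat (GX.mk a) = P a) ∧
        Continuous Phat ∧
        Function.Surjective Phat ∧
        (Phat.ker : Set GX) = GX.mk '' centerSet ∧
        Phat.ker ≠ ⊥ ∧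
        Phat.ker.Normal ∧
        IsClosed (Phat.ker : Set GX) ∧
        ContractibleSpace Phat.ker ∧
        PathConnectedSpace Phat.ker ∧
        LocallySimplyConnected Phat.ker ∧
        LocallyPathConnectedSpace Phat.ker := by
  exact ⟨inferInstance, inferInstance, CoeffSeq.returnMap, CoeffSeq.isFirstReturnMap_iff,
    CoeffSeq.returnMap_mul, GX.returnHom, GX.returnHom_mk, GX.continuous_returnHom,
    GX.returnHom_surjective, GX.ker_returnHom, GX.ker_returnHom_ne_bot, inferInstance,
    GX.isClosed_ker_returnHom, inferInstance, inferInstance, GX.locallySimplyConnected_ker,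
    GX.locallySimplyConnected_ker.locallyPathConnectedSpace⟩
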